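/- Let $m\ge 1$ be odd, $k\in\mathbb N_0$, $\alpha\in\mathbb R$. Let $\mathbb R_{0,m}$ be the real Clifford algebra generated by $e_1,\dots,e_m$ with $e_ie_j+e_je_i=-2\delta_{ij}$, identify $\underline x\in\mathbb R^m$ with $\sum_j x_je_j$, and let $\partial_{\underline x}=\sum_{j=1}^m e_j\partial_{x_j}$ be the Dirac operator. A $C^1$ function $F:\Omega\to\mathbb R_{0,m}$ on an open set $\Omega\subseteq\mathbb R^{m+1}$ is called monogenic if $(\partial_{x_0}+\partial_{\underline x})F=0$ in $\Omega$. Let $P_k:\mathbb R^m\to\mathbb R_{0,m}$ be a homogeneous polynomial of degree $k$ with $\partial_{\underline x}P_k=0$. For $h=u+iv$ put, with $r=|\underline x|$ and $\underline\omega=\underline x/r$ (the term with $\underline\omega$ being $0$ for $r=0$), $$\mathsf{Ft}[h(z),P_k](x_0,\underline x)=\Delta^{k+\frac{m-1}{2}}\bigl[(u(x_0,r)+\underline\omega\,v(x_0,r))P_k(\underline x)\bigr],\qquad \Delta=\sum_{j=0}^m\partial_{x_j}^2,$$ and let $$\mathsf{CK}[g](x_0,\underline x)=\sum_{n=0}^\infty\frac{(-x_0)^n}{n!}\,\partial_{\underline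 x}^n g(\underline x).$$ Let $(1+z^2)^{\beta}$ denote the principal branch, and put $$c=(-2)^{k+\frac{m-1}{2}}\,(2k+m-1)!!\prod_{j=1}^{k+\frac{m-1}{2}}(\alpha+j).$$ **Theorem.** For all $(x_0,\underline x)\in\mathbb R^{m+1}$ with $|x_0|+|\underline x|<1$ the series defining $\mathsf{CK}\bigl[(1-|\underline x|^2)^\alpha P_k\bigr](x_0,\underline x)$ converges and $$\mathsf{Ft}\Bigl[(1+z^2)^{\alpha+k+\frac{m-1}{2}},P_k\Bigr](x_0,\underline x)=c\;\mathsf{CK}\bigl[(1-|\underline x|^2)^\alpha P_k\bigr](x_0,\underline x).$$ Moreover, $\mathsf{Ft}\bigl[(1+z^2)^{\alpha+k+\frac{m-1}{2}},P_k\bigr]$ is a monogenic extension of $c\,(1-|\underline x|^2)^\alpha P_k(\underline x)$ from the unit ball $|\underline x|<1$ of $\mathbb R^m=\{x_0=0\}$ to the whole cylinder $\{(x_0,\underline x):|\underline x|<1\}$ in $\mathbb R^{m+1}$. -/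

import Mathlib

noncomputable section

namespace CliffordFueter

/-- Euclidean space `ℝ^n`. -/
abbrev E (n : ℕ) : Type := EuclideanSpace ℝ (Fin n)

/-- The quadratic form `x ↦ -∑ x_j²` on `ℝ^m`. -/
abbrev negSq (m : ℕ) : QuadraticForm ℝ (Fin m → ℝ) :=
  QuadraticMap.weightedSumSquares ℝ (fun _ : Fin m => (-1 : ℝ))

/-- The real Clifford algebra `ℝ_{0,m}`. -/
abbrev Cl (m : ℕ) : Type := CliffordAlgebra (negSq m)

/-- The embedding of vectors `x = ∑ x_j e_j` into `ℝ_{0,m}`. -/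
def vec {m : ℕ} (x : E m) : Cl m := CliffordAlgebra.ι (negSq m) x.ofLp

/-- The generators `e_1, …, e_m` (indexed from `0`). -/
def gen {m : ℕ} (j : Fin m) : Cl m := CliffordAlgebra.ι (negSq m) (Pi.single j 1)

/-- A basis of `ℝ_{0,m}` indexed by the subsets of `{1, …, m}`. -/
def basis (m : ℕ) : Module.Basis (Finset (Fin m)) ℝ (Cl m) :=
  ((Pi.basisFun ℝ (Fin m)).ExteriorAlgebra).map (CliffordAlgebra.equivExterior (negSq m)).symm

attribute [local instance] Matrix.linftyOpNormedRing Matrix.linftyOpNormedAlgebra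

/-- The finite-dimensional algebra `ℝ_{0,m}` is topologised by a norm (all norms on it are
equivalent, so derivatives, smoothness and convergence do not depend on the choice): the operator
norm of left multiplication, which is submultiplicative. -/
instance instNormedRingCl (m : ℕ) : NormedRing (Cl m) :=
  NormedRing.induced (Cl m) (Matrix (Finset (Fin m)) (Finset (Fin m)) ℝ)
    (Algebra.leftMulMatrix (basis m)) (Algebra.leftMulMatrix_injective (basis m))

instance instNormedAlgebraCl (m : ℕ) : NormedAlgebra ℝ (Cl m) :=
  NormedAlgebra.induced ℝ (Cl m) (Matrix (Finset (Fin m)) (Finset (Fin m)) ℝ)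
    (Algebra.leftMulMatrix (basis m))

/-- The Dirac operator `∑_j e_j ∂_{x_j}` on `ℝ^m`. -/
def dirac {m : ℕ} (f : E m → Cl m) (x : E m) : Cl m :=
  ∑ j : Fin m, gen j * fderiv ℝ f x (EuclideanSpace.single j 1)

/-- The vector part `x = (x_1, …, x_m)` of `X = (x_0, x_1, …, x_m) ∈ ℝ^{m+1}`; the scalar part
`x_0` is `X 0`. -/
def vpart {m : ℕ} (X : E (m + 1)) : E m := WithLp.toLp 2 (fun j : Fin m => X j.succ)

/-- The generalized Cauchy-Riemann operator `∂_{x_0} + ∑_j e_j ∂_{x_j}` on `ℝ^{m+1}`. -/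
def cauchyRiemann {m : ℕ} (f : E (m + 1) → Cl m) (X : E (m + 1)) : Cl m :=
  fderiv ℝ f X (EuclideanSpace.single 0 1) +
    ∑ j : Fin m, gen j * fderiv ℝ f X (EuclideanSpace.single j.succ 1)

/-- `f` is (left) monogenic in the open set `Ω ⊆ ℝ^{m+1}`. -/
def MonogenicOn {m : ℕ} (f : E (m + 1) → Cl m) (Ω : Set (E (m + 1))) : Prop :=
  ContDiffOn ℝ 1 f Ω ∧ ∀ X ∈ Ω, cauchyRiemann f X = 0

/-- `F` is a monogenic extension to `Ω ⊆ ℝ^{m+1}` of `g`, a function on `U ⊆ ℝ^m`, where `ℝ^m` is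
identified with the hyperplane `x_0 = 0` of `ℝ^{m+1}`. -/
def IsMonogenicExtension {m : ℕ} (g : E m → Cl m) (U : Set (E m))
    (F : E (m + 1) → Cl m) (Ω : Set (E (m + 1))) : Prop :=
  MonogenicOn F Ω ∧ ∀ X : E (m + 1), X 0 = 0 → vpart X ∈ U → X ∈ Ω ∧ F X = g (vpart X)

/-- `P : ℝ^m → ℝ_{0,m}` is a homogeneous polynomial of degree `k`: a sum of monomials
`x_1^{d_1} ⋯ x_m^{d_m}` of total degree `k` with coefficients in `ℝ_{0,m}`. -/
def IsHomogeneousPolynomial {m : ℕ} (k : ℕ) (P : E m → Cl m) : Prop :=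
  ∃ c : (Fin m → ℕ) → Cl m, ∀ x : E m,
    P x = ∑ d ∈ Finset.piAntidiag (Finset.univ : Finset (Fin m)) k, (∏ j, x j ^ d j) • c d

/-- `P` is a homogeneous monogenic polynomial of degree `k` in `ℝ^m`. -/
def IsHomogeneousMonogenic {m : ℕ} (k : ℕ) (P : E m → Cl m) : Prop :=
  IsHomogeneousPolynomial k P ∧ ∀ x, dirac P x = 0

/-- The `n`-th term `(-x_0)^n / n! · (∂^n g)(x)` of the Cauchy-Kowalevski series of `g` at
`X = (x_0, x)`, where `∂` is the Dirac operator. -/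
def ckTerm {m : ℕ} (g : E m → Cl m) (X : E (m + 1)) (n : ℕ) : Cl m :=
  ((-X 0) ^ n / (n.factorial : ℝ)) • (dirac^[n] g) (vpart X)

/-- The Cauchy-Kowalevski extension `CK[g](x_0, x) = ∑_n (-x_0)^n / n! · (∂^n g)(x)`. -/
def CK {m : ℕ} (g : E m → Cl m) (X : E (m + 1)) : Cl m := ∑' n, ckTerm g X n

/-- The function `(u(x_0, r) + ω v(x_0, r)) P(x)` on `ℝ^{m+1}`, where `h = u + i v`, `r = |x|` and
`ω = x / r`. For `r = 0` the term with `ω` is zero. -/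
def axial {m : ℕ} (h : ℂ → ℂ) (P : E m → Cl m) (X : E (m + 1)) : Cl m :=
  (algebraMap ℝ (Cl m) (h ⟨X 0, ‖vpart X‖⟩).re
    + (h ⟨X 0, ‖vpart X‖⟩).im • (‖vpart X‖⁻¹ • vec (vpart X))) * P (vpart X)

/-- The Fueter transform `Ft[h, P] = Δ^{k+(m-1)/2} [(u(x_0, r) + ω v(x_0, r)) P(x)]` (for odd `m`
and `P` of degree `k`), with `Δ` the Laplacian of `ℝ^{m+1}`. -/
def Ft {m : ℕ} (k : ℕ) (h : ℂ → ℂ) (P : E m → Cl m) : E (m + 1) → Cl m :=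
  (fun f : E (m + 1) → Cl m => Laplacian.laplacian f)^[k + (m - 1) / 2] (axial h P)

/-- The weight function `(1 - |x|²)^α P(x)`. -/
def weight {m : ℕ} (α : ℝ) (P : E m → Cl m) (x : E m) : Cl m := ((1 - ‖x‖ ^ 2) ^ α) • P x

/-- The function `h(z) = (1 + z²)^β`, principal branch. -/
def onePlusSqPow (β : ℝ) (z : ℂ) : ℂ := (1 + z ^ 2) ^ (β : ℂ)

/-- The constant `(-2)^{k+(m-1)/2} (2k+m-1)!! ∏_{j=1}^{k+(m-1)/2} (α + j)`. -/
def fueterConst (m k : ℕ) (α : ℝ) : ℝ :=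
  (-2) ^ (k + (m - 1) / 2) * (Nat.doubleFactorial (2 * k + m - 1) : ℝ) *
    ∏ j ∈ Finset.Icc 1 (k + (m - 1) / 2), (α + (j : ℝ))

end CliffordFueter

end

/-!
In the coordinates `(t, s) = (x_0, |x|²)` an axial function has, off the axis `x = 0`, the form
`(U + x W) P` with `U`, `W` functions of `(t, s)`. For a holomorphic `h` the Cauchy-Riemann
equations read `∂_t U = κ W + 2 s ∂_s W`, `∂_t W = -2 ∂_s U` with `κ = 1`. Under this system the
Cauchy-Riemann operator sends `(U + x W) P` to `(κ - 2k - m) W P`, and its conjugate sends `W P` to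
`-2 (∂_s U + x ∂_s W) P`; hence the Laplacian, the composition of the two, is a constant times
`∂_s`, and `∂_s` turns `κ` into `κ + 2`. After `N = k + (m-1)/2` steps `κ = 2k + m` and the function
is monogenic off the axis. Near the axis the axial function is a power series in `x_0 + x` times
`P`, so everything is real analytic and monogenicity extends by density. On `x_0 = 0` one has
`h(i√s) = (1 - s)^{α+N}`, whose `N`-th derivative in `s` produces the product `∏ (α + j)`.

A monogenic `F` satisfies `∂_{x_0} F = -∂ F`, so the Taylor series of `F` in `x_0` is the
Cauchy-Kowalevski series of its restriction to `x_0 = 0`. The weight is a power series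
`∑ b_l x^l` times `P`, on which `∂` shifts the coefficients and multiplies them by factors of
modulus at most `l + 1 + 2k + m`; with `d = 2k + m` the Cauchy-Kowalevski series is therefore
dominated by the binomial expansion of `∑ |b_l| (|x_0| + ρ)^{l+d}` for any `ρ` slightly larger than
`|x|`, which converges when `|x_0| + |x| < 1`.
-/

noncomputable section

namespace CliffordFueter

open scoped Topology
open Filter

instance instFiniteDimensionalCl (m : ℕ) : FiniteDimensional ℝ (Cl m) :=
  (basis m).finiteDimensional_of_finite

instance instCompleteSpaceCl (m : ℕ) : CompleteSpace (Cl m) := FiniteDimensional.complete ℝ (Cl m)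

variable {m k : ℕ} {P : E m → Cl m}

section CliffordAlgebra

/-- The embedding `vec` of `ℝ^m` into `ℝ_{0,m}` as a continuous linear map. -/
def vecCLM (m : ℕ) : E m →L[ℝ] Cl m :=
  LinearMap.toContinuousLinearMap
    (CliffordAlgebra.ι (negSq m) ∘ₗ (WithLp.linearEquiv 2 ℝ (Fin m → ℝ)).toLinearMap)

theorem coe_vecCLM : ⇑(vecCLM m) = vec := rfl

theorem vec_single (j : Fin m) : vec (EuclideanSpace.single j (1 : ℝ)) = gen j := rfl

theorem negSq_apply (x : E m) : negSq m x.ofLp = -‖x‖ ^ 2 := by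
  rw [QuadraticMap.weightedSumSquares_apply, EuclideanSpace.norm_sq_eq]
  simp [pow_two]

theorem vec_mul_vec_add_swap (x y : E m) :
    vec x * vec y + vec y * vec x = algebraMap ℝ (Cl m) (-2 * inner ℝ x y) := by
  rw [vec, vec, CliffordAlgebra.ι_mul_ι_add_swap, QuadraticMap.polar, ← WithLp.ofLp_add,
    negSq_apply, negSq_apply, negSq_apply, norm_add_sq_real]
  congr 1
  ring

theorem vec_mul_vec_mul (x : E m) (a : Cl m) : vec x * (vec x * a) = (-‖x‖ ^ 2) • a := by
  rw [← mul_assoc, vec, CliffordAlgebra.ι_sq_scalar, negSq_apply, Algebra.smul_def]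

theorem gen_mul_gen_add_swap (i j : Fin m) :
    gen i * gen j + gen j * gen i = algebraMap ℝ (Cl m) (if i = j then -2 else 0) := by
  rw [← vec_single, ← vec_single, vec_mul_vec_add_swap]
  congr 1
  by_cases h : i = j <;> simp [EuclideanSpace.inner_single_left, h]

theorem gen_mul_vec (j : Fin m) (x : E m) :
    gen j * vec x = algebraMap ℝ (Cl m) (-2 * x j) - vec x * gen j := by
  rw [← vec_single, eq_sub_iff_add_eq, vec_mul_vec_add_swap]
  simp [EuclideanSpace.inner_single_left]

theorem sum_gen_mul_smul (x : E m) (a : Cl m) : ∑ j, gen j * (x j • a) = vec x * a := by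
  conv_rhs => rw [← (EuclideanSpace.basisFun (Fin m) ℝ).sum_repr x, ← coe_vecCLM, map_sum]
  simp [Finset.sum_mul, coe_vecCLM, vec_single]

theorem sum_gen_mul_gen_mul (a : Cl m) : ∑ j : Fin m, gen j * (gen j * a) = (-(m : ℝ)) • a := by
  have gen_sq (j : Fin m) : gen j * (gen j * a) = (-1 : ℝ) • a := by
    rw [← vec_single, vec_mul_vec_mul]
    simp
  simp_rw [gen_sq]
  simp [← Nat.cast_smul_eq_nsmul ℝ]

theorem sum_sum_gen_mul_gen_mul {B : Fin m → Fin m → Cl m} (hB : ∀ i j, B i j = B j i) :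
    ∑ i, ∑ j, gen i * (gen j * B i j) = -∑ i, B i i := by
  have swap : ∑ i, ∑ j, gen i * (gen j * B i j) = ∑ i, ∑ j, gen j * (gen i * B i j) := by
    rw [Finset.sum_comm]
    simp_rw [hB]
  have double : (2 : ℝ) • ∑ i, ∑ j, gen i * (gen j * B i j) = (2 : ℝ) • -∑ i, B i i := by
    rw [two_smul]
    nth_rewrite 2 [swap]
    simp_rw [← Finset.sum_add_distrib, ← mul_assoc, ← add_mul, gen_mul_gen_add_swap,
      ← Algebra.smul_def, ite_smul, zero_smul, Finset.sum_ite_eq, Finset.mem_univ, if_true,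
      ← Finset.smul_sum, smul_neg, neg_smul]
  exact smul_right_injective _ (two_ne_zero (α := ℝ)) double

theorem vec_pow_two_mul (x : E m) (n : ℕ) :
    vec x ^ (2 * n) = algebraMap ℝ (Cl m) ((-‖x‖ ^ 2) ^ n) := by
  rw [pow_mul, pow_two, vec, CliffordAlgebra.ι_sq_scalar, negSq_apply, map_pow]

theorem norm_vec_pow_le (x : E m) (l : ℕ) :
    ‖vec x ^ l‖ ≤ (‖(1 : Cl m)‖ + ‖vecCLM m‖ * ‖(1 : Cl m)‖) * ‖x‖ ^ l := by
  have even_case (n : ℕ) : ‖vec x ^ (2 * n)‖ = ‖(1 : Cl m)‖ * ‖x‖ ^ (2 * n) := by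
    rw [vec_pow_two_mul, norm_algebraMap, norm_pow, norm_neg, norm_pow, norm_norm, pow_mul,
      mul_comm]
  obtain ⟨n, rfl | rfl⟩ := l.even_or_odd'
  · rw [even_case, add_mul]
    exact le_add_of_nonneg_right (by positivity)
  · calc ‖vec x ^ (2 * n + 1)‖ ≤ ‖vec x‖ * ‖vec x ^ (2 * n)‖ := by
          rw [pow_succ']
          exact norm_mul_le _ _
      _ ≤ (‖vecCLM m‖ * ‖x‖) * (‖(1 : Cl m)‖ * ‖x‖ ^ (2 * n)) := by
          rw [even_case]
          gcongr
          exact (vecCLM m).le_opNorm x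
      _ = ‖vecCLM m‖ * ‖(1 : Cl m)‖ * ‖x‖ ^ (2 * n + 1) := by ring
      _ ≤ (‖(1 : Cl m)‖ + ‖vecCLM m‖ * ‖(1 : Cl m)‖) * ‖x‖ ^ (2 * n + 1) := by
          gcongr
          exact le_add_of_nonneg_left (norm_nonneg _)

end CliffordAlgebra

section Dirac

variable {f g : E m → Cl m} {x : E m}

theorem dirac_eventuallyEq (h : f =ᶠ[𝓝 x] g) : dirac f =ᶠ[𝓝 x] dirac g := by
  filter_upwards [h.eventuallyEq_nhds] with y hy
  simp only [dirac, hy.fderiv_eq]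

theorem iterate_dirac_eventuallyEq (h : f =ᶠ[𝓝 x] g) (n : ℕ) :
    dirac^[n] f =ᶠ[𝓝 x] dirac^[n] g := by
  induction n with
  | zero => exact h
  | succ n ih =>
    rw [Function.iterate_succ_apply', Function.iterate_succ_apply']
    exact dirac_eventuallyEq ih

theorem dirac_const_smul (c : ℝ) (f : E m → Cl m) :
    dirac (fun y => c • f y) = fun y => c • dirac f y := by
  funext y
  have smul_fderiv : fderiv ℝ (fun z => c • f z) y = c • fderiv ℝ f y :=
    congrFun (fderiv_const_smul_field c) y
  simp [dirac, smul_fderiv, Finset.smul_sum]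

theorem iterate_dirac_const_smul (c : ℝ) (f : E m → Cl m) (n : ℕ) :
    dirac^[n] (fun y => c • f y) = fun y => c • dirac^[n] f y := by
  induction n generalizing f with
  | zero => rfl
  | succ n ih => rw [Function.iterate_succ_apply, dirac_const_smul, ih, Function.iterate_succ_apply]

theorem dirac_radial_smul {φ : ℝ → ℝ} {φ' : ℝ} (hφ : HasDerivAt φ φ' (‖x‖ ^ 2))
    (hf : DifferentiableAt ℝ f x) :
    dirac (fun y => φ (‖y‖ ^ 2) • f y) x = (2 * φ') • (vec x * f x) + φ (‖x‖ ^ 2) • dirac f x := by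
  have hφ_norm : HasFDerivAt (fun y : E m => φ (‖y‖ ^ 2)) (φ' • (2 • innerSL ℝ x)) x :=
    hφ.comp_hasFDerivAt x (hasStrictFDerivAt_norm_sq x).hasFDerivAt
  have partial_deriv (j : Fin m) :
      gen j * fderiv ℝ (fun y => φ (‖y‖ ^ 2) • f y) x (EuclideanSpace.single j 1) =
        (2 * φ') • (gen j * (x j • f x)) +
          φ (‖x‖ ^ 2) • (gen j * fderiv ℝ f x (EuclideanSpace.single j 1)) := by
    rw [(hφ_norm.fun_smul hf.hasFDerivAt).fderiv]
    simp [EuclideanSpace.inner_single_right, mul_add, smul_smul, mul_assoc, mul_left_comm, add_comm]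
  rw [dirac, Finset.sum_congr rfl fun j _ => partial_deriv j, Finset.sum_add_distrib,
    ← Finset.smul_sum, ← Finset.smul_sum, sum_gen_mul_smul, dirac]

theorem dirac_vec_mul (hf : DifferentiableAt ℝ f x) :
    dirac (fun y => vec y * f y) x =
      (-(m : ℝ)) • f x - (2 : ℝ) • fderiv ℝ f x x - vec x * dirac f x := by
  have partial_deriv (j : Fin m) :
      gen j * fderiv ℝ (fun y => vec y * f y) x (EuclideanSpace.single j 1) =
        gen j * (gen j * f x) - (2 : ℝ) • fderiv ℝ f x (x j • EuclideanSpace.single j 1)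
          - vec x * (gen j * fderiv ℝ f x (EuclideanSpace.single j 1)) := by
    have product_rule : fderiv ℝ (fun y => vec y * f y) x =
        vec x • fderiv ℝ f x + MulOpposite.op (f x) • vecCLM m :=
      ((vecCLM m).hasFDerivAt.mul' hf.hasFDerivAt).fderiv
    rw [product_rule]
    simp only [add_apply, smul_apply, smul_eq_mul, coe_vecCLM, vec_single,
      MulOpposite.smul_eq_mul_unop, MulOpposite.unop_op, mul_add, ← mul_assoc, gen_mul_vec, neg_mul,
      map_neg, map_mul, sub_mul, map_smul, Algebra.smul_def]
    abel
  have sum_coordinates : ∑ j, x j • EuclideanSpace.single j (1 : ℝ) = x := by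
    simpa using (EuclideanSpace.basisFun (Fin m) ℝ).sum_repr x
  rw [dirac, Finset.sum_congr rfl fun j _ => partial_deriv j, Finset.sum_sub_distrib,
    Finset.sum_sub_distrib, ← Finset.smul_sum, ← map_sum, ← Finset.mul_sum, sum_gen_mul_gen_mul,
    sum_coordinates, dirac]

end Dirac

section HomogeneousPolynomial

theorem IsHomogeneousPolynomial.analyticAt (hP : IsHomogeneousPolynomial k P) (x : E m) :
    AnalyticAt ℝ P x := by
  obtain ⟨c, hc⟩ := hP
  rw [funext hc]
  refine Finset.analyticAt_fun_sum _ fun d _ => AnalyticAt.fun_smul ?_ analyticAt_const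
  exact Finset.analyticAt_fun_prod _ fun j _ =>
    ((EuclideanSpace.proj (𝕜 := ℝ) j).analyticAt x).fun_pow _

theorem IsHomogeneousPolynomial.differentiableAt (hP : IsHomogeneousPolynomial k P) (x : E m) :
    DifferentiableAt ℝ P x :=
  (hP.analyticAt x).differentiableAt

theorem IsHomogeneousPolynomial.smul_apply (hP : IsHomogeneousPolynomial k P) (t : ℝ) (x : E m) :
    P (t • x) = t ^ k • P x := by
  obtain ⟨c, hc⟩ := hP
  rw [hc, hc, Finset.smul_sum]
  refine Finset.sum_congr rfl fun d hd => ?_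
  rw [smul_smul, ← (Finset.mem_piAntidiag.1 hd).1, ← Finset.prod_pow_eq_pow_sum,
    ← Finset.prod_mul_distrib]
  simp [mul_pow]

theorem IsHomogeneousPolynomial.fderiv_apply_self (hP : IsHomogeneousPolynomial k P) (x : E m) :
    fderiv ℝ P x x = (k : ℝ) • P x := by
  have along_ray : HasDerivAt (fun t : ℝ => P (t • x)) (fderiv ℝ P x x) 1 := by
    have hray : HasDerivAt (fun t : ℝ => t • x) x 1 := by
      simpa using (hasDerivAt_id (1 : ℝ)).smul_const x
    exact HasFDerivAt.comp_hasDerivAt 1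
      (by simpa only [one_smul] using (hP.differentiableAt x).hasFDerivAt) hray
  have by_homogeneity : HasDerivAt (fun t : ℝ => P (t • x)) ((k : ℝ) • P x) 1 := by
    simp_rw [hP.smul_apply]
    simpa using (hasDerivAt_pow k (1 : ℝ)).smul_const (P x)
  exact along_ray.unique by_homogeneity

theorem IsHomogeneousMonogenic.dirac_vec_mul (hP : IsHomogeneousMonogenic k P) (x : E m) :
    dirac (fun y => vec y * P y) x = (-(2 * k + m : ℝ)) • P x := by
  rw [CliffordFueter.dirac_vec_mul (hP.1.differentiableAt x), hP.1.fderiv_apply_self, hP.2,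
    mul_zero, sub_zero, smul_smul, ← sub_smul]
  congr 1
  ring

end HomogeneousPolynomial

section FDeriv

theorem analyticAt_fderiv_apply {V W : Type*} [NormedAddCommGroup V] [NormedSpace ℝ V]
    [NormedAddCommGroup W] [NormedSpace ℝ W] [CompleteSpace W] {f : V → W} {x : V}
    (hf : AnalyticAt ℝ f x) (v : V) : AnalyticAt ℝ (fun y => fderiv ℝ f y v) x :=
  ((ContinuousLinearMap.apply ℝ W v).analyticAt _).comp hf.fderiv

end FDeriv

section Coordinates

/-- The vector part `vpart` as a continuous linear map. -/
def vpartCLM (m : ℕ) : E (m + 1) →L[ℝ] E m :=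
  LinearMap.toContinuousLinearMap
    { toFun := vpart
      map_add' := fun _ _ => rfl
      map_smul' := fun _ _ => rfl }

theorem coe_vpartCLM : ⇑(vpartCLM m) = vpart := rfl

/-- The scalar part `X ↦ x_0` as a continuous linear map. -/
def spartCLM (m : ℕ) : E (m + 1) →L[ℝ] ℝ := EuclideanSpace.proj (𝕜 := ℝ) 0

theorem spartCLM_apply (X : E (m + 1)) : spartCLM m X = X 0 := rfl

/-- The point `(t, x)` of `ℝ^{m+1} = ℝ × ℝ^m`. -/
def join (t : ℝ) (x : E m) : E (m + 1) := WithLp.toLp 2 (Fin.cons t x.ofLp)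

@[simp] theorem join_apply_zero (t : ℝ) (x : E m) : join t x 0 = t := rfl

@[simp] theorem vpart_join (t : ℝ) (x : E m) : vpart (join t x) = x := rfl

@[simp] theorem join_vpart (X : E (m + 1)) : join (X 0) (vpart X) = X := by
  ext i
  exact Fin.cases rfl (fun _ => rfl) i

/-- The embedding `x ↦ (0, x)` of `ℝ^m` as the hyperplane `x_0 = 0`, as a continuous linear map. -/
def hyperplaneCLM (m : ℕ) : E m →L[ℝ] E (m + 1) :=
  LinearMap.toContinuousLinearMap
    { toFun := join 0
      map_add' := fun x y => by
        ext i
        refine Fin.cases ?_ (fun _ => rfl) i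
        simp [join]
      map_smul' := fun c x => by
        ext i
        refine Fin.cases ?_ (fun _ => rfl) i
        simp [join] }

theorem hyperplaneCLM_apply (x : E m) : hyperplaneCLM m x = join 0 x := rfl

theorem hyperplaneCLM_single (j : Fin m) :
    hyperplaneCLM m (EuclideanSpace.single j 1) = EuclideanSpace.single j.succ 1 := by
  ext i
  refine Fin.cases ?_ (fun _ => ?_) i <;> simp [hyperplaneCLM_apply, join, Pi.single_apply]

theorem join_eq_smul_add (t : ℝ) (x : E m) :
    join t x = t • EuclideanSpace.single 0 1 + hyperplaneCLM m x := by
  ext i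
  refine Fin.cases ?_ (fun _ => ?_) i <;> simp [hyperplaneCLM_apply, join]

theorem hasDerivAt_join (t : ℝ) (x : E m) :
    HasDerivAt (fun t => join t x) (EuclideanSpace.single 0 1) t := by
  simp_rw [join_eq_smul_add]
  simpa using ((hasDerivAt_id t).smul_const
    (EuclideanSpace.single (0 : Fin (m + 1)) (1 : ℝ))).add_const (hyperplaneCLM m x)

theorem hasFDerivAt_join (t : ℝ) (x : E m) : HasFDerivAt (join t) (hyperplaneCLM m) x := by
  rw [funext (join_eq_smul_add t)]
  exact (hyperplaneCLM m).hasFDerivAt.const_add _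

theorem analyticAt_join_left (t : ℝ) (x : E m) : AnalyticAt ℝ (fun t => join t x) t := by
  simp_rw [join_eq_smul_add]
  fun_prop

theorem continuous_join (t : ℝ) : Continuous (join t : E m → E (m + 1)) :=
  continuous_iff_continuousAt.2 fun x => (hasFDerivAt_join t x).continuousAt

end Coordinates

section CauchyRiemann

variable {f g : E (m + 1) → Cl m} {X : E (m + 1)}

/-- The conjugate Cauchy-Riemann operator `∂_{x_0} - ∑_j e_j ∂_{x_j}`; its composition with
`cauchyRiemann` is the Laplacian of `ℝ^{m+1}`. -/
def conjCauchyRiemann (f : E (m + 1) → Cl m) (X : E (m + 1)) : Cl m :=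
  fderiv ℝ f X (EuclideanSpace.single 0 1) -
    ∑ j : Fin m, gen j * fderiv ℝ f X (EuclideanSpace.single j.succ 1)

theorem cauchyRiemann_eventuallyEq (h : f =ᶠ[𝓝 X] g) :
    cauchyRiemann f =ᶠ[𝓝 X] cauchyRiemann g := by
  filter_upwards [h.eventuallyEq_nhds] with Y hY
  simp only [cauchyRiemann, hY.fderiv_eq]

theorem conjCauchyRiemann_eventuallyEq (h : f =ᶠ[𝓝 X] g) :
    conjCauchyRiemann f =ᶠ[𝓝 X] conjCauchyRiemann g := by
  filter_upwards [h.eventuallyEq_nhds] with Y hY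
  simp only [conjCauchyRiemann, hY.fderiv_eq]

theorem cauchyRiemann_add (hf : DifferentiableAt ℝ f X) (hg : DifferentiableAt ℝ g X) :
    cauchyRiemann (fun Y => f Y + g Y) X = cauchyRiemann f X + cauchyRiemann g X := by
  simp only [cauchyRiemann, fderiv_fun_add hf hg, add_apply, mul_add, Finset.sum_add_distrib]
  abel

theorem cauchyRiemann_const_smul (c : ℝ) (f : E (m + 1) → Cl m) (X : E (m + 1)) :
    cauchyRiemann (fun Y => c • f Y) X = c • cauchyRiemann f X := by
  have smul_fderiv : fderiv ℝ (fun Y => c • f Y) X = c • fderiv ℝ f X :=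
    congrFun (fderiv_const_smul_field c) X
  simp [cauchyRiemann, smul_fderiv, Finset.smul_sum, smul_add]

theorem conjCauchyRiemann_const_smul (c : ℝ) (f : E (m + 1) → Cl m) (X : E (m + 1)) :
    conjCauchyRiemann (fun Y => c • f Y) X = c • conjCauchyRiemann f X := by
  have smul_fderiv : fderiv ℝ (fun Y => c • f Y) X = c • fderiv ℝ f X :=
    congrFun (fderiv_const_smul_field c) X
  simp [conjCauchyRiemann, smul_fderiv, Finset.smul_sum, smul_sub]

theorem deriv_comp_join (hf : DifferentiableAt ℝ f X) :
    deriv (fun t => f (join t (vpart X))) (X 0) = fderiv ℝ f X (EuclideanSpace.single 0 1) := by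
  have hfX : HasFDerivAt f (fderiv ℝ f X) (join (X 0) (vpart X)) := by
    rw [join_vpart]
    exact hf.hasFDerivAt
  exact (hfX.comp_hasDerivAt _ (hasDerivAt_join _ _)).deriv

theorem dirac_comp_join (hf : DifferentiableAt ℝ f X) :
    dirac (fun y => f (join (X 0) y)) (vpart X) =
      ∑ j : Fin m, gen j * fderiv ℝ f X (EuclideanSpace.single j.succ 1) := by
  have hfX : HasFDerivAt f (fderiv ℝ f X) (join (X 0) (vpart X)) := by
    rw [join_vpart]
    exact hf.hasFDerivAt
  have chain_rule : fderiv ℝ (fun y => f (join (X 0) y)) (vpart X) =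
      (fderiv ℝ f X).comp (hyperplaneCLM m) := (hfX.comp _ (hasFDerivAt_join _ _)).fderiv
  simp [dirac, chain_rule, hyperplaneCLM_single]

theorem cauchyRiemann_eq_deriv_add_dirac (hf : DifferentiableAt ℝ f X) :
    cauchyRiemann f X = deriv (fun t => f (join t (vpart X))) (X 0) +
      dirac (fun y => f (join (X 0) y)) (vpart X) := by
  rw [cauchyRiemann, deriv_comp_join hf, dirac_comp_join hf]

theorem conjCauchyRiemann_eq_deriv_sub_dirac (hf : DifferentiableAt ℝ f X) :
    conjCauchyRiemann f X = deriv (fun t => f (join t (vpart X))) (X 0) -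
      dirac (fun y => f (join (X 0) y)) (vpart X) := by
  rw [conjCauchyRiemann, deriv_comp_join hf, dirac_comp_join hf]

theorem analyticAt_cauchyRiemann (hf : AnalyticAt ℝ f X) : AnalyticAt ℝ (cauchyRiemann f) X :=
  (analyticAt_fderiv_apply hf _).fun_add (Finset.analyticAt_fun_sum _ fun _ _ =>
    analyticAt_const.fun_mul (analyticAt_fderiv_apply hf _))

theorem analyticAt_conjCauchyRiemann (hf : AnalyticAt ℝ f X) :
    AnalyticAt ℝ (conjCauchyRiemann f) X :=
  (analyticAt_fderiv_apply hf _).fun_sub (Finset.analyticAt_fun_sum _ fun _ _ =>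
    analyticAt_const.fun_mul (analyticAt_fderiv_apply hf _))

theorem fderiv_cauchyRiemann (hf : ContDiffAt ℝ 2 f X) (v : E (m + 1)) :
    fderiv ℝ (cauchyRiemann f) X v =
      fderiv ℝ (fderiv ℝ f) X v (EuclideanSpace.single 0 1) +
        ∑ j : Fin m, gen j * fderiv ℝ (fderiv ℝ f) X v (EuclideanSpace.single j.succ 1) := by
  have hf' : HasFDerivAt (fderiv ℝ f) (fderiv ℝ (fderiv ℝ f) X) X :=
    ((hf.fderiv_right (m := 1) le_rfl).differentiableAt one_ne_zero).hasFDerivAt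
  have hpartial (w : E (m + 1)) := hf'.clm_apply (hasFDerivAt_const w X)
  have hCR : HasFDerivAt (cauchyRiemann f) _ X :=
    (hpartial (EuclideanSpace.single 0 1)).add
      (HasFDerivAt.fun_sum (u := Finset.univ) fun (j : Fin m) _ =>
        (hpartial (EuclideanSpace.single j.succ 1)).const_mul (gen j))
  rw [hCR.fderiv]
  simp

theorem conjCauchyRiemann_cauchyRiemann (hf : ContDiffAt ℝ 2 f X) :
    conjCauchyRiemann (cauchyRiemann f) X = Laplacian.laplacian f X := by
  set B := fderiv ℝ (fderiv ℝ f) X with hB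
  have B_symm (v w : E (m + 1)) : B v w = B w v :=
    hf.isSymmSndFDerivAt (by simp [minSmoothness_of_isRCLikeNormedField]) v w
  have cross_terms := sum_sum_gen_mul_gen_mul (m := m)
    (B := fun i j => B (EuclideanSpace.single i.succ 1) (EuclideanSpace.single j.succ 1))
    fun _ _ => B_symm _ _
  rw [InnerProductSpace.laplacian_eq_iteratedFDeriv_orthonormalBasis f
    (EuclideanSpace.basisFun (Fin (m + 1)) ℝ), conjCauchyRiemann]
  simp only [fderiv_cauchyRiemann hf, iteratedFDeriv_two_apply, Fin.sum_univ_succ, ← hB,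
    EuclideanSpace.basisFun_apply, Matrix.cons_val_zero, Matrix.cons_val_one, mul_add,
    Finset.sum_add_distrib, Finset.mul_sum, cross_terms,
    B_symm (EuclideanSpace.single 0 1) (EuclideanSpace.single (Fin.succ _) 1)]
  abel

theorem analyticAt_laplacian (hf : AnalyticAt ℝ f X) :
    AnalyticAt ℝ (Laplacian.laplacian f) X := by
  refine (analyticAt_conjCauchyRiemann (analyticAt_cauchyRiemann hf)).congr ?_
  filter_upwards [hf.eventually_analyticAt] with Y hY
  exact conjCauchyRiemann_cauchyRiemann hY.contDiffAt

theorem analyticAt_iterate_laplacian (hf : AnalyticAt ℝ f X) (n : ℕ) :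
    AnalyticAt ℝ ((fun f : E (m + 1) → Cl m => Laplacian.laplacian f)^[n] f) X := by
  induction n with
  | zero => exact hf
  | succ n ih =>
    rw [Function.iterate_succ_apply']
    exact analyticAt_laplacian ih

end CauchyRiemann

section PartialDerivatives

/-- The partial derivative `∂_t f` of a function of `(t, s)`. -/
def fstDeriv (f : ℝ × ℝ → ℝ) (q : ℝ × ℝ) : ℝ := fderiv ℝ f q (1, 0)

/-- The partial derivative `∂_s f` of a function of `(t, s)`. -/
def sndDeriv (f : ℝ × ℝ → ℝ) (q : ℝ × ℝ) : ℝ := fderiv ℝ f q (0, 1)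

variable {f g : ℝ × ℝ → ℝ} {q : ℝ × ℝ} {S : Set (ℝ × ℝ)}

theorem sndDeriv_eqOn (hS : IsOpen S) (h : Set.EqOn f g S) :
    Set.EqOn (sndDeriv f) (sndDeriv g) S := fun q hq => by
  rw [sndDeriv, (h.eventuallyEq_of_mem (hS.mem_nhds hq)).fderiv_eq, sndDeriv]

theorem analyticOnNhd_sndDeriv (hf : AnalyticOnNhd ℝ f S) : AnalyticOnNhd ℝ (sndDeriv f) S :=
  fun q hq => analyticAt_fderiv_apply (hf q hq) _

theorem analyticOnNhd_iterate_sndDeriv (hf : AnalyticOnNhd ℝ f S) (n : ℕ) :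
    AnalyticOnNhd ℝ (sndDeriv^[n] f) S := by
  induction n with
  | zero => exact hf
  | succ n ih =>
    rw [Function.iterate_succ_apply']
    exact analyticOnNhd_sndDeriv ih

theorem fstDeriv_sndDeriv (hf : ContDiffAt ℝ 2 f q) :
    fstDeriv (sndDeriv f) q = sndDeriv (fstDeriv f) q := by
  have hf' : DifferentiableAt ℝ (fderiv ℝ f) q :=
    (hf.fderiv_right (m := 1) le_rfl).differentiableAt one_ne_zero
  have second_partial (v w : ℝ × ℝ) :
      fderiv ℝ (fun p => fderiv ℝ f p w) q v = fderiv ℝ (fderiv ℝ f) q v w := by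
    rw [(hf'.hasFDerivAt.clm_apply (hasFDerivAt_const w q)).fderiv]
    simp
  have symm : IsSymmSndFDerivAt ℝ f q :=
    hf.isSymmSndFDerivAt (by simp [minSmoothness_of_isRCLikeNormedField])
  exact (second_partial _ _).trans ((symm _ _).trans (second_partial _ _).symm)

theorem hasDerivAt_comp_prodMk_left (hf : DifferentiableAt ℝ f q) :
    HasDerivAt (fun t => f (t, q.2)) (fstDeriv f q) q.1 :=
  hf.hasFDerivAt.comp_hasDerivAt q.1 ((hasDerivAt_id q.1).prodMk (hasDerivAt_const q.1 q.2))

theorem hasDerivAt_comp_prodMk_right (hf : DifferentiableAt ℝ f q) :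
    HasDerivAt (fun s => f (q.1, s)) (sndDeriv f q) q.2 :=
  hf.hasFDerivAt.comp_hasDerivAt q.2 ((hasDerivAt_const q.2 q.1).prodMk (hasDerivAt_id q.2))

theorem iterate_sndDeriv_eq_iteratedDeriv (hS : IsOpen S) (hf : AnalyticOnNhd ℝ f S) (n : ℕ)
    (hq : q ∈ S) : sndDeriv^[n] f q = iteratedDeriv n (fun s => f (q.1, s)) q.2 := by
  induction n generalizing q with
  | zero => rfl
  | succ n ih =>
    have near_q : ∀ᶠ s in 𝓝 q.2, (q.1, s) ∈ S :=
      (Continuous.prodMk_right q.1).continuousAt.eventually (hS.mem_nhds hq)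
    have ih' : (fun s => sndDeriv^[n] f (q.1, s)) =ᶠ[𝓝 q.2]
        iteratedDeriv n (fun s => f (q.1, s)) := by
      filter_upwards [near_q] with s hs
      exact ih hs
    rw [Function.iterate_succ_apply', iteratedDeriv_succ, ← ih'.deriv_eq]
    exact (hasDerivAt_comp_prodMk_right
      (analyticOnNhd_iterate_sndDeriv hf n q hq).differentiableAt).deriv.symm

end PartialDerivatives

section VekuaPair

/-- A Vekua-type generalization of the Cauchy-Riemann equations in the coordinates
`(t, s) = (x_0, |x|²)`: for `κ = 1` the solutions are the pairs `(u, v / r)` with `u + i v`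
holomorphic in `t + i r`, `s = r²`; in general they are the pairs for which `U + x W` has
`∂_{x_0} + ∂_x` proportional to `W`. -/
structure IsVekuaPair (κ : ℝ) (S : Set (ℝ × ℝ)) (U W : ℝ × ℝ → ℝ) : Prop where
  analytic_left : AnalyticOnNhd ℝ U S
  analytic_right : AnalyticOnNhd ℝ W S
  fstDeriv_left : ∀ q ∈ S, fstDeriv U q = κ * W q + 2 * q.2 * sndDeriv W q
  fstDeriv_right : ∀ q ∈ S, fstDeriv W q = -2 * sndDeriv U q

variable {κ : ℝ} {S : Set (ℝ × ℝ)} {U W : ℝ × ℝ → ℝ}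

protected theorem IsVekuaPair.sndDeriv (hS : IsOpen S) (h : IsVekuaPair κ S U W) :
    IsVekuaPair (κ + 2) S (sndDeriv U) (sndDeriv W) where
  analytic_left := analyticOnNhd_sndDeriv h.analytic_left
  analytic_right := analyticOnNhd_sndDeriv h.analytic_right
  fstDeriv_left q hq := by
    have hW := (h.analytic_right q hq).differentiableAt.hasFDerivAt
    have hW' := (analyticOnNhd_sndDeriv h.analytic_right q hq).differentiableAt.hasFDerivAt
    have product_rule : HasFDerivAt (fun p => κ * W p + 2 * p.2 * sndDeriv W p) _ q :=
      (hW.const_mul κ).add (((hasFDerivAt_snd (𝕜 := ℝ) (p := q)).const_mul 2).mul hW')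
    rw [fstDeriv_sndDeriv (h.analytic_left q hq).contDiffAt, sndDeriv_eqOn hS h.fstDeriv_left hq,
      sndDeriv, product_rule.fderiv, sndDeriv, sndDeriv]
    simp only [add_apply, smul_apply, smul_eq_mul, ContinuousLinearMap.coe_snd']
    ring
  fstDeriv_right q hq := by
    have hU' := (analyticOnNhd_sndDeriv h.analytic_left q hq).differentiableAt
    rw [fstDeriv_sndDeriv (h.analytic_right q hq).contDiffAt,
      sndDeriv_eqOn hS h.fstDeriv_right hq, sndDeriv, fderiv_const_mul hU', sndDeriv]
    rfl

theorem IsVekuaPair.iterate_sndDeriv (hS : IsOpen S) (h : IsVekuaPair κ S U W) (n : ℕ) :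
    IsVekuaPair (κ + 2 * n) S (sndDeriv^[n] U) (sndDeriv^[n] W) := by
  induction n with
  | zero => simpa using h
  | succ n ih =>
    rw [Function.iterate_succ_apply', Function.iterate_succ_apply',
      show κ + 2 * (n + 1 : ℕ) = κ + 2 * n + 2 by push_cast; ring]
    exact ih.sndDeriv hS

end VekuaPair

section Radial

/-- The coordinates `(t, s) = (x_0, |x|²)` of a point of `ℝ^{m+1}`. -/
def radialCoords (X : E (m + 1)) : ℝ × ℝ := (X 0, ‖vpart X‖ ^ 2)

/-- The function `A(x_0, |x|²) Q(x)` on `ℝ^{m+1}`. -/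
def radial (A : ℝ × ℝ → ℝ) (Q : E m → Cl m) (X : E (m + 1)) : Cl m :=
  A (radialCoords X) • Q (vpart X)

/-- The function `(U(x_0, |x|²) + x W(x_0, |x|²)) P(x)` on `ℝ^{m+1}`. -/
def radialPair (U W : ℝ × ℝ → ℝ) (P : E m → Cl m) (X : E (m + 1)) : Cl m :=
  radial U P X + radial W (fun x => vec x * P x) X

theorem analyticAt_radialCoords (X : E (m + 1)) : AnalyticAt ℝ radialCoords X := by
  have hnorm : ContDiffAt ℝ ⊤ (fun Y : E (m + 1) => ‖vpart Y‖ ^ 2) X :=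
    ((vpartCLM m).contDiff.norm_sq ℝ).contDiffAt
  exact ((spartCLM m).analyticAt X).prod hnorm.analyticAt

theorem isOpen_radialCoords_preimage {S : Set (ℝ × ℝ)} (hS : IsOpen S) :
    IsOpen (radialCoords ⁻¹' S : Set (E (m + 1))) :=
  hS.preimage (continuous_iff_continuousAt.2 fun X => (analyticAt_radialCoords X).continuousAt)

variable {A : ℝ × ℝ → ℝ} {Q : E m → Cl m} {X : E (m + 1)}

theorem analyticAt_radial (hA : AnalyticAt ℝ A (radialCoords X))
    (hQ : AnalyticAt ℝ Q (vpart X)) : AnalyticAt ℝ (radial A Q) X :=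
  (hA.comp (analyticAt_radialCoords X)).fun_smul
    (AnalyticAt.comp (g := Q) hQ ((vpartCLM m).analyticAt X))

theorem differentiableAt_radial (hA : DifferentiableAt ℝ A (radialCoords X))
    (hQ : DifferentiableAt ℝ Q (vpart X)) : DifferentiableAt ℝ (radial A Q) X :=
  (hA.comp X (analyticAt_radialCoords X).differentiableAt).fun_smul
    (DifferentiableAt.comp (g := Q) X hQ (vpartCLM m).differentiableAt)

theorem deriv_radial_join (hA : DifferentiableAt ℝ A (radialCoords X)) (Q : E m → Cl m) :
    deriv (fun t => radial A Q (join t (vpart X))) (X 0) =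
      fstDeriv A (radialCoords X) • Q (vpart X) :=
  ((hasDerivAt_comp_prodMk_left hA).smul_const (Q (vpart X))).deriv

theorem dirac_radial_join (hA : DifferentiableAt ℝ A (radialCoords X))
    (hQ : DifferentiableAt ℝ Q (vpart X)) :
    dirac (fun y => radial A Q (join (X 0) y)) (vpart X) =
      (2 * sndDeriv A (radialCoords X)) • (vec (vpart X) * Q (vpart X)) +
        A (radialCoords X) • dirac Q (vpart X) :=
  dirac_radial_smul (φ := fun s => A (X 0, s)) (hasDerivAt_comp_prodMk_right hA) hQ

theorem cauchyRiemann_radial (hA : DifferentiableAt ℝ A (radialCoords X))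
    (hQ : DifferentiableAt ℝ Q (vpart X)) :
    cauchyRiemann (radial A Q) X = fstDeriv A (radialCoords X) • Q (vpart X) +
      ((2 * sndDeriv A (radialCoords X)) • (vec (vpart X) * Q (vpart X)) +
        A (radialCoords X) • dirac Q (vpart X)) := by
  rw [cauchyRiemann_eq_deriv_add_dirac (differentiableAt_radial hA hQ), deriv_radial_join hA,
    dirac_radial_join hA hQ]

theorem conjCauchyRiemann_radial (hA : DifferentiableAt ℝ A (radialCoords X))
    (hQ : DifferentiableAt ℝ Q (vpart X)) :
    conjCauchyRiemann (radial A Q) X = fstDeriv A (radialCoords X) • Q (vpart X) -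
      ((2 * sndDeriv A (radialCoords X)) • (vec (vpart X) * Q (vpart X)) +
        A (radialCoords X) • dirac Q (vpart X)) := by
  rw [conjCauchyRiemann_eq_deriv_sub_dirac (differentiableAt_radial hA hQ), deriv_radial_join hA,
    dirac_radial_join hA hQ]

variable {κ : ℝ} {S : Set (ℝ × ℝ)} {U W : ℝ × ℝ → ℝ}

theorem analyticAt_vec_mul {x : E m} (hQ : AnalyticAt ℝ Q x) :
    AnalyticAt ℝ (fun y => vec y * Q y) x :=
  ((vecCLM m).analyticAt x).fun_mul hQ

theorem IsVekuaPair.analyticAt_radialPair (h : IsVekuaPair κ S U W)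
    (hP : AnalyticAt ℝ P (vpart X)) (hX : radialCoords X ∈ S) :
    AnalyticAt ℝ (radialPair U W P) X :=
  (analyticAt_radial (h.analytic_left _ hX) hP).fun_add
    (analyticAt_radial (h.analytic_right _ hX) (analyticAt_vec_mul hP))

theorem IsVekuaPair.cauchyRiemann_radialPair (h : IsVekuaPair κ S U W)
    (hP : IsHomogeneousMonogenic k P) (hX : radialCoords X ∈ S) :
    cauchyRiemann (radialPair U W P) X = (κ - (2 * k + m)) • radial W P X := by
  have hU := (h.analytic_left _ hX).differentiableAt
  have hW := (h.analytic_right _ hX).differentiableAt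
  have hPd := hP.1.differentiableAt (vpart X)
  have hvP := (analyticAt_vec_mul (hP.1.analyticAt (vpart X))).differentiableAt
  have split := cauchyRiemann_add (differentiableAt_radial hU hPd) (differentiableAt_radial hW hvP)
  refine split.trans ?_
  rw [cauchyRiemann_radial hU hPd, cauchyRiemann_radial hW hvP, h.fstDeriv_left _ hX,
    h.fstDeriv_right _ hX, hP.2, hP.dirac_vec_mul, vec_mul_vec_mul, radial]
  simp only [radialCoords]
  module

theorem IsVekuaPair.conjCauchyRiemann_radial_right (h : IsVekuaPair κ S U W)
    (hP : IsHomogeneousMonogenic k P) (hX : radialCoords X ∈ S) :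
    conjCauchyRiemann (radial W P) X =
      (-2 : ℝ) • radialPair (sndDeriv U) (sndDeriv W) P X := by
  rw [conjCauchyRiemann_radial (h.analytic_right _ hX).differentiableAt
    (hP.1.differentiableAt (vpart X)), h.fstDeriv_right _ hX, hP.2, radialPair, radial, radial]
  module

theorem IsVekuaPair.laplacian_radialPair (hS : IsOpen S) (h : IsVekuaPair κ S U W)
    (hP : IsHomogeneousMonogenic k P) (hX : radialCoords X ∈ S) :
    Laplacian.laplacian (radialPair U W P) X =
      (2 * (2 * k + m - κ)) • radialPair (sndDeriv U) (sndDeriv W) P X := by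
  have cauchyRiemann_near_X : cauchyRiemann (radialPair U W P) =ᶠ[𝓝 X]
      fun Y => (κ - (2 * k + m)) • radial W P Y := by
    filter_upwards [(isOpen_radialCoords_preimage hS).mem_nhds hX] with Y hY
    exact h.cauchyRiemann_radialPair hP hY
  rw [← conjCauchyRiemann_cauchyRiemann
      (h.analyticAt_radialPair (hP.1.analyticAt _) hX).contDiffAt,
    (conjCauchyRiemann_eventuallyEq cauchyRiemann_near_X).eq_of_nhds,
    conjCauchyRiemann_const_smul, h.conjCauchyRiemann_radial_right hP hX, smul_smul]
  congr 1
  ring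

theorem IsVekuaPair.iterate_laplacian_radialPair (hS : IsOpen S) (h : IsVekuaPair κ S U W)
    (hP : IsHomogeneousMonogenic k P) (n : ℕ) (hX : radialCoords X ∈ S) :
    (fun f : E (m + 1) → Cl m => Laplacian.laplacian f)^[n] (radialPair U W P) X =
      (∏ i ∈ Finset.range n, (2 * (2 * k + m - κ - 2 * i) : ℝ)) •
        radialPair (sndDeriv^[n] U) (sndDeriv^[n] W) P X := by
  induction n generalizing X with
  | zero => simp
  | succ n ih =>
    have hn := h.iterate_sndDeriv hS n
    have ih_near_X : (fun f : E (m + 1) → Cl m => Laplacian.laplacian f)^[n] (radialPair U W P)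
        =ᶠ[𝓝 X] (∏ i ∈ Finset.range n, (2 * (2 * k + m - κ - 2 * i) : ℝ)) •
          radialPair (sndDeriv^[n] U) (sndDeriv^[n] W) P := by
      filter_upwards [(isOpen_radialCoords_preimage hS).mem_nhds hX] with Y hY
      exact ih hY
    rw [Function.iterate_succ_apply',
      (InnerProductSpace.laplacian_congr_nhds ih_near_X).eq_of_nhds,
      InnerProductSpace.laplacian_smul _
        (hn.analyticAt_radialPair (hP.1.analyticAt _) hX).contDiffAt,
      hn.laplacian_radialPair hS hP hX, smul_smul, Finset.prod_range_succ,
      Function.iterate_succ_apply', Function.iterate_succ_apply', sub_sub _ κ]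

end Radial

section Holomorphic

/-- The point `t + i √s` of the closed upper half-plane with coordinates `(t, s)`. -/
def halfPlanePoint (q : ℝ × ℝ) : ℂ := ⟨q.1, √q.2⟩

/-- The real part `u` of `h = u + i v` in the coordinates `(t, s) = (x_0, r²)`. -/
def rePart (h : ℂ → ℂ) (q : ℝ × ℝ) : ℝ := (h (halfPlanePoint q)).re

/-- The quotient `v / r` for `h = u + i v` in the coordinates `(t, s) = (x_0, r²)`. -/
def imPart (h : ℂ → ℂ) (q : ℝ × ℝ) : ℝ := (h (halfPlanePoint q)).im * (√q.2)⁻¹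

theorem axial_eq_radialPair (h : ℂ → ℂ) (P : E m → Cl m) :
    axial h P = radialPair (rePart h) (imPart h) P := by
  funext X
  simp only [axial, radialPair, radial, radialCoords, rePart, imPart, halfPlanePoint,
    Real.sqrt_sq (norm_nonneg _)]
  rw [add_mul, ← Algebra.smul_def, smul_smul, smul_mul_assoc]

variable {h : ℂ → ℂ} {q : ℝ × ℝ}

theorem analyticAt_sqrt_snd (hq : 0 < q.2) : AnalyticAt ℝ (fun q : ℝ × ℝ => √q.2) q :=
  (contDiffAt_snd.sqrt hq.ne' : ContDiffAt ℝ ⊤ _ q).analyticAt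

theorem halfPlanePoint_eq_symm_apply :
    halfPlanePoint = fun q => Complex.equivRealProdCLM.symm (q.1, √q.2) :=
  funext fun _ => (Complex.equivRealProd_symm_apply _).symm ▸ Complex.mk_eq_add_mul_I _ _

theorem analyticAt_comp_halfPlanePoint (hq : 0 < q.2) (hh : AnalyticAt ℂ h (halfPlanePoint q)) :
    AnalyticAt ℝ (fun q => h (halfPlanePoint q)) q := by
  refine AnalyticAt.comp (g := h) (hh.restrictScalars (𝕜 := ℝ)) ?_
  rw [halfPlanePoint_eq_symm_apply]
  exact AnalyticAt.comp (g := Complex.equivRealProdCLM.symm)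
    (Complex.equivRealProdCLM.symm.analyticAt _) (analyticAt_fst.prod (analyticAt_sqrt_snd hq))

theorem analyticAt_rePart (hq : 0 < q.2) (hh : AnalyticAt ℂ h (halfPlanePoint q)) :
    AnalyticAt ℝ (rePart h) q :=
  (Complex.reCLM.analyticAt _).comp (analyticAt_comp_halfPlanePoint hq hh)

theorem analyticAt_imPart (hq : 0 < q.2) (hh : AnalyticAt ℂ h (halfPlanePoint q)) :
    AnalyticAt ℝ (imPart h) q :=
  ((Complex.imCLM.analyticAt _).comp (analyticAt_comp_halfPlanePoint hq hh)).fun_mul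
    ((analyticAt_sqrt_snd hq).fun_inv (Real.sqrt_pos.2 hq).ne')

theorem hasFDerivAt_sqrt_snd (hq : 0 < q.2) :
    HasFDerivAt (fun q : ℝ × ℝ => √q.2) ((1 / (2 * √q.2)) • ContinuousLinearMap.snd ℝ ℝ ℝ) q :=
  (Real.hasDerivAt_sqrt hq.ne').comp_hasFDerivAt q hasFDerivAt_snd

theorem hasFDerivAt_halfPlanePoint (hq : 0 < q.2) :
    HasFDerivAt halfPlanePoint ((Complex.equivRealProdCLM.symm : ℝ × ℝ →L[ℝ] ℂ).comp
      ((ContinuousLinearMap.fst ℝ ℝ ℝ).prod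
        ((1 / (2 * √q.2)) • ContinuousLinearMap.snd ℝ ℝ ℝ))) q := by
  rw [halfPlanePoint_eq_symm_apply]
  exact (Complex.equivRealProdCLM.symm : ℝ × ℝ →L[ℝ] ℂ).hasFDerivAt.comp q
    (hasFDerivAt_fst.prodMk (hasFDerivAt_sqrt_snd hq))

theorem exists_hasFDerivAt_comp_halfPlanePoint (hq : 0 < q.2)
    (hh : DifferentiableAt ℂ h (halfPlanePoint q)) :
    ∃ L : ℝ × ℝ →L[ℝ] ℂ, HasFDerivAt (fun q => h (halfPlanePoint q)) L q ∧
      L (1, 0) = deriv h (halfPlanePoint q) ∧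
      L (0, 1) = (2 * √q.2)⁻¹ • (Complex.I * deriv h (halfPlanePoint q)) := by
  refine ⟨_, HasFDerivAt.comp (g := h) q (hh.hasDerivAt.hasFDerivAt.restrictScalars ℝ)
    (hasFDerivAt_halfPlanePoint hq), ?_, ?_⟩ <;>
  simp [Complex.equivRealProdCLM_symm_apply, mul_assoc]

theorem fstDeriv_rePart (hq : 0 < q.2) (hh : DifferentiableAt ℂ h (halfPlanePoint q)) :
    fstDeriv (rePart h) q = (deriv h (halfPlanePoint q)).re := by
  obtain ⟨L, hL, L_fst, -⟩ := exists_hasFDerivAt_comp_halfPlanePoint hq hh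
  have hre : HasFDerivAt (rePart h) (Complex.reCLM.comp L) q := Complex.reCLM.hasFDerivAt.comp q hL
  simp [fstDeriv, hre.fderiv, L_fst]

theorem sndDeriv_rePart (hq : 0 < q.2) (hh : DifferentiableAt ℂ h (halfPlanePoint q)) :
    sndDeriv (rePart h) q = -((2 * √q.2)⁻¹ * (deriv h (halfPlanePoint q)).im) := by
  obtain ⟨L, hL, -, L_snd⟩ := exists_hasFDerivAt_comp_halfPlanePoint hq hh
  have hre : HasFDerivAt (rePart h) (Complex.reCLM.comp L) q := Complex.reCLM.hasFDerivAt.comp q hL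
  simp [sndDeriv, hre.fderiv, L_snd]

theorem hasFDerivAt_imPart {L : ℝ × ℝ →L[ℝ] ℂ} (hq : 0 < q.2)
    (hL : HasFDerivAt (fun q => h (halfPlanePoint q)) L q) :
    HasFDerivAt (imPart h) ((h (halfPlanePoint q)).im •
      ((-(1 / (2 * √q.2)) / √q.2 ^ 2) • ContinuousLinearMap.snd ℝ ℝ ℝ) +
        (√q.2)⁻¹ • Complex.imCLM.comp L) q :=
  (Complex.imCLM.hasFDerivAt.comp q hL).mul
    (((Real.hasDerivAt_sqrt hq.ne').inv (Real.sqrt_pos.2 hq).ne').comp_hasFDerivAt q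
      hasFDerivAt_snd)

theorem fstDeriv_imPart (hq : 0 < q.2) (hh : DifferentiableAt ℂ h (halfPlanePoint q)) :
    fstDeriv (imPart h) q = (√q.2)⁻¹ * (deriv h (halfPlanePoint q)).im := by
  obtain ⟨L, hL, L_fst, -⟩ := exists_hasFDerivAt_comp_halfPlanePoint hq hh
  simp [fstDeriv, (hasFDerivAt_imPart hq hL).fderiv, L_fst]

theorem sndDeriv_imPart (hq : 0 < q.2) (hh : DifferentiableAt ℂ h (halfPlanePoint q)) :
    sndDeriv (imPart h) q = (2 * q.2)⁻¹ * ((deriv h (halfPlanePoint q)).re - imPart h q) := by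
  obtain ⟨L, hL, -, L_snd⟩ := exists_hasFDerivAt_comp_halfPlanePoint hq hh
  have L_snd_im : (L (0, 1)).im = (2 * √q.2)⁻¹ * (deriv h (halfPlanePoint q)).re := by
    simp [L_snd]
  simp only [sndDeriv, (hasFDerivAt_imPart hq hL).fderiv, imPart, Real.sq_sqrt hq.le, add_apply,
    smul_apply, smul_eq_mul, ContinuousLinearMap.comp_apply, ContinuousLinearMap.coe_snd',
    Complex.imCLM_apply, L_snd_im]
  field_simp
  linear_combination -(deriv h (halfPlanePoint q)).re * Real.sq_sqrt hq.le

/-- The set of coordinates `(t, s)` with `s > 0` and `t + i √s` in `U`. -/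
def offAxisCoords (U : Set ℂ) : Set (ℝ × ℝ) := {q | 0 < q.2 ∧ halfPlanePoint q ∈ U}

theorem isOpen_offAxisCoords {U : Set ℂ} (hU : IsOpen U) : IsOpen (offAxisCoords U) := by
  refine (isOpen_lt continuous_const continuous_snd).inter (hU.preimage ?_)
  rw [halfPlanePoint_eq_symm_apply]
  fun_prop

theorem isVekuaPair_of_analyticOnNhd {U : Set ℂ} (hh : AnalyticOnNhd ℂ h U) :
    IsVekuaPair 1 (offAxisCoords U) (rePart h) (imPart h) where
  analytic_left _ hq := analyticAt_rePart hq.1 (hh _ hq.2)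
  analytic_right _ hq := analyticAt_imPart hq.1 (hh _ hq.2)
  fstDeriv_left q hq := by
    have hh' := (hh _ hq.2).differentiableAt
    rw [fstDeriv_rePart hq.1 hh', sndDeriv_imPart hq.1 hh',
      mul_inv_cancel_left₀ (mul_pos two_pos hq.1).ne']
    ring
  fstDeriv_right q hq := by
    have hh' := (hh _ hq.2).differentiableAt
    rw [fstDeriv_imPart hq.1 hh', sndDeriv_rePart hq.1 hh', mul_inv]
    ring

end Holomorphic

section RealPowerSeries

variable {h : ℂ → ℂ} {a : ℝ}

theorem eventually_im_iteratedDeriv_eq_zero (hh : AnalyticAt ℂ h a)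
    (hreal : ∀ᶠ x : ℝ in 𝓝 a, (h x).im = 0) (n : ℕ) :
    ∀ᶠ x : ℝ in 𝓝 a, (iteratedDeriv n h x).im = 0 := by
  induction n with
  | zero => simpa using hreal
  | succ n ih =>
    have analytic_near_a : ∀ᶠ x : ℝ in 𝓝 a, AnalyticAt ℂ h x :=
      Complex.continuous_ofReal.continuousAt.eventually hh.eventually_analyticAt
    filter_upwards [analytic_near_a, ih.eventually_nhds] with x hx ih_near_x
    have hderiv : HasDerivAt (fun y : ℝ => (iteratedDeriv n h y).im)
        (iteratedDeriv (n + 1) h x).im x := by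
      simp only [iteratedDeriv_eq_iterate, Function.iterate_succ_apply']
      exact Complex.imCLM.hasFDerivAt.comp_hasDerivAt x
        (AnalyticAt.iterated_deriv hx n).differentiableAt.hasDerivAt.comp_ofReal
    exact hderiv.unique ((hasDerivAt_const x (0 : ℝ)).congr_of_eventuallyEq ih_near_x)

theorem exists_hasFPowerSeriesAt_ofScalars_ofReal (hh : AnalyticAt ℂ h a)
    (hreal : ∀ᶠ x : ℝ in 𝓝 a, (h x).im = 0) :
    ∃ c : ℕ → ℝ,
      HasFPowerSeriesAt h (FormalMultilinearSeries.ofScalars ℂ fun n => (c n : ℂ)) a := by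
  refine ⟨fun n => (iteratedDeriv n h a).re / n.factorial, ?_⟩
  have hseries := hh.hasFPowerSeriesAt
  have hcoeff (n : ℕ) : iteratedDeriv n h a / n.factorial =
      (((iteratedDeriv n h a).re / n.factorial : ℝ) : ℂ) := by
    have him := (eventually_im_iteratedDeriv_eq_zero hh hreal n).self_of_nhds
    push_cast
    rw [← Complex.re_add_im (iteratedDeriv n h a), him]
    simp
  simpa only [hcoeff] using hseries

theorem radius_ofScalars_ofReal_le (A : Type*) [NormedRing A] [NormedAlgebra ℝ A] (c : ℕ → ℝ) :
    (FormalMultilinearSeries.ofScalars ℂ fun n => (c n : ℂ)).radius ≤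
      (FormalMultilinearSeries.ofScalars A c).radius := by
  refine ENNReal.le_of_forall_nnreal_lt fun r hr => ?_
  obtain ⟨C, -, hC⟩ := FormalMultilinearSeries.norm_mul_pow_le_of_lt_radius _ hr
  refine FormalMultilinearSeries.le_radius_of_bound _
    (max C ‖FormalMultilinearSeries.ofScalars A c 0‖) fun n => ?_
  rcases Nat.eq_zero_or_pos n with rfl | hn
  · exact le_max_of_le_right (by rw [pow_zero, mul_one])
  · refine le_max_of_le_left (le_trans ?_ (hC n))
    gcongr
    exact (FormalMultilinearSeries.ofScalars_norm_le A c n hn).trans_eq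
      (by rw [FormalMultilinearSeries.ofScalars_norm, Complex.norm_real])

theorem hasSum_smul_paravector_pow {c : ℕ → ℝ} {t : ℝ} {x : E m} {w : ℂ}
    (hw : HasSum (fun n => c n • (⟨t, ‖x‖⟩ : ℂ) ^ n) w) :
    HasSum (fun n => c n • (algebraMap ℝ (Cl m) t + vec x) ^ n)
      (algebraMap ℝ (Cl m) w.re + w.im • (‖x‖⁻¹ • vec x)) := by
  by_cases hx : x = 0
  · have vec_zero : vec (0 : E m) = 0 := (vecCLM m).map_zero
    have ht : (⟨t, ‖(0 : E m)‖⟩ : ℂ) = t := by apply Complex.ext <;> simp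
    subst hx
    have hre : HasSum (fun n => c n * t ^ n) w.re := by
      simpa only [ht, Complex.smul_re, ← Complex.ofReal_pow, Complex.ofReal_re, smul_eq_mul]
        using Complex.hasSum_re hw
    simpa [vec_zero, Algebra.smul_def] using hre.mapL (algebraMapCLM ℝ (Cl m))
  · have hx' : ‖x‖ ≠ 0 := norm_ne_zero_iff.2 hx
    have sq_direction : (‖x‖⁻¹ • vec x) * (‖x‖⁻¹ • vec x) = -1 := by
      have hsq : vec x * vec x = (-‖x‖ ^ 2) • 1 := by simpa using vec_mul_vec_mul x (1 : Cl m)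
      rw [smul_mul_smul_comm, hsq, smul_smul,
        show ‖x‖⁻¹ * ‖x‖⁻¹ * -‖x‖ ^ 2 = -1 by field_simp, neg_one_smul]
    set L := Complex.liftAux (‖x‖⁻¹ • vec x) sq_direction
    have hL (z : ℂ) : L z = algebraMap ℝ (Cl m) z.re + z.im • (‖x‖⁻¹ • vec x) :=
      Complex.liftAux_apply _ sq_direction z
    have L_point : L ⟨t, ‖x‖⟩ = algebraMap ℝ (Cl m) t + vec x := by
      rw [hL, smul_smul, mul_inv_cancel₀ hx', one_smul]
    rw [← hL, ← L_point]
    simpa only [LinearMap.coe_toContinuousLinearMap', AlgHom.toLinearMap_apply, map_smul, map_pow]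
      using hw.mapL L.toLinearMap.toContinuousLinearMap

end RealPowerSeries

section AxialAnalytic

variable {h : ℂ → ℂ} {X : E (m + 1)}

theorem analyticAt_axial_of_vpart_ne_zero (hX : vpart X ≠ 0)
    (hh : AnalyticAt ℂ h ⟨X 0, ‖vpart X‖⟩) (hP : AnalyticAt ℝ P (vpart X)) :
    AnalyticAt ℝ (axial h P) X := by
  have hpos : 0 < (radialCoords X).2 := pow_pos (norm_pos_iff.2 hX) 2
  have hpoint : halfPlanePoint (radialCoords X) = ⟨X 0, ‖vpart X‖⟩ := by
    simp [halfPlanePoint, radialCoords]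
  rw [← hpoint] at hh
  rw [axial_eq_radialPair]
  exact (analyticAt_radial (analyticAt_rePart hpos hh) hP).fun_add
    (analyticAt_radial (analyticAt_imPart hpos hh) (analyticAt_vec_mul hP))

theorem analyticAt_axial_of_vpart_eq_zero (hX : vpart X = 0) (hh : AnalyticAt ℂ h (X 0))
    (hreal : ∀ᶠ x : ℝ in 𝓝 (X 0), (h x).im = 0) (hP : AnalyticAt ℝ P (vpart X)) :
    AnalyticAt ℝ (axial h P) X := by
  obtain ⟨c, hc⟩ := exists_hasFPowerSeriesAt_ofScalars_ofReal hh hreal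
  set S := FormalMultilinearSeries.ofScalars (Cl m) c with hS
  have hball := S.hasFPowerSeriesOnBall (hc.radius_pos.trans_le (radius_ofScalars_ofReal_le _ c))
  let paravector (Y : E (m + 1)) : Cl m := algebraMap ℝ (Cl m) (Y 0 - X 0) + vec (vpart Y)
  have hpara : AnalyticAt ℝ paravector X :=
    ((algebraMapCLM ℝ (Cl m)).analyticAt _).comp
      (((spartCLM m).analyticAt X).fun_sub analyticAt_const) |>.add
    (((vecCLM m).comp (vpartCLM m)).analyticAt X)
  have hparaX : paravector X = 0 := by simp [paravector, hX, ← coe_vecCLM]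
  have hsum : AnalyticAt ℝ (fun Y => S.sum (paravector Y) * P (vpart Y)) X :=
    (AnalyticAt.comp (g := S.sum) (hparaX ▸ hball.analyticAt) hpara).fun_mul
      (AnalyticAt.comp (g := P) hP ((vpartCLM m).analyticAt X))
  have tendsto_complex :
      Tendsto (fun Y : E (m + 1) => (⟨Y 0 - X 0, ‖vpart Y‖⟩ : ℂ)) (𝓝 X) (𝓝 0) := by
    have hcont : Continuous fun Y : E (m + 1) =>
        Complex.equivRealProdCLM.symm (spartCLM m Y - X 0, ‖vpartCLM m Y‖) := by fun_prop
    have hlim := hcont.tendsto X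
    simpa [hX, Complex.mk_eq_add_mul_I, Complex.equivRealProdCLM_symm_apply, spartCLM_apply,
      coe_vpartCLM] using hlim
  refine hsum.congr ?_
  filter_upwards [tendsto_complex.eventually (hasFPowerSeriesAt_iff.1 hc),
    (hparaX ▸ hpara.continuousAt.tendsto).eventually
      hball.hasFPowerSeriesAt.eventually_hasSum] with Y hY hSY
  have htranslate : ((X 0 : ℝ) : ℂ) + ⟨Y 0 - X 0, ‖vpart Y‖⟩ = ⟨Y 0, ‖vpart Y‖⟩ := by
    apply Complex.ext <;> simp
  simp only [zero_add, hS, FormalMultilinearSeries.ofScalars_apply_eq] at hSY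
  rw [htranslate] at hY
  have hterms := hasSum_smul_paravector_pow (c := c) (t := Y 0 - X 0) (x := vpart Y)
    (by simpa [mul_comm] using hY)
  rw [axial, ← hSY.unique hterms]

end AxialAnalytic

section FueterTheorem

/-- The axially symmetric domain of `ℝ^{m+1}` swept out by a domain `U` of the complex plane. -/
def axialDomain (m : ℕ) (U : Set ℂ) : Set (E (m + 1)) := {X | (⟨X 0, ‖vpart X‖⟩ : ℂ) ∈ U}

variable {h : ℂ → ℂ} {U : Set ℂ} {X : E (m + 1)}

theorem isOpen_axialDomain (hU : IsOpen U) : IsOpen (axialDomain m U) := by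
  have hcont : Continuous fun X : E (m + 1) =>
      Complex.equivRealProdCLM.symm (spartCLM m X, ‖vpartCLM m X‖) := by fun_prop
  convert hU.preimage hcont using 1
  ext X
  simp [axialDomain, Complex.mk_eq_add_mul_I, Complex.equivRealProdCLM_symm_apply, spartCLM_apply,
    coe_vpartCLM]

theorem dense_setOf_vpart_ne_zero [NeZero m] : Dense {X : E (m + 1) | vpart X ≠ 0} := by
  have vpart_surjective : Function.Surjective (vpartCLM m) := fun x =>
    ⟨join 0 x, by rw [coe_vpartCLM, vpart_join]⟩
  have hdense := (dense_compl_singleton (0 : E m)).preimage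
    ((vpartCLM m).isOpenMap vpart_surjective)
  rwa [coe_vpartCLM] at hdense

theorem radialCoords_mem_offAxisCoords_iff :
    radialCoords X ∈ offAxisCoords U ↔ vpart X ≠ 0 ∧ X ∈ axialDomain m U := by
  simp [radialCoords, offAxisCoords, axialDomain, halfPlanePoint, sq_pos_iff]

theorem analyticOnNhd_axial (hU : IsOpen U) (hh : AnalyticOnNhd ℂ h U)
    (hreal : ∀ x : ℝ, (x : ℂ) ∈ U → (h x).im = 0) (hP : AnalyticOnNhd ℝ P Set.univ) :
    AnalyticOnNhd ℝ (axial h P) (axialDomain m U) := fun X hX => by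
  by_cases hX0 : vpart X = 0
  · have real_point : ((X 0 : ℝ) : ℂ) ∈ U := by
      rw [axialDomain, Set.mem_ofPred_eq, hX0, norm_zero] at hX
      exact hX
    refine analyticAt_axial_of_vpart_eq_zero hX0 (hh _ real_point) ?_ (hP _ trivial)
    filter_upwards [(hU.preimage Complex.continuous_ofReal).mem_nhds real_point] with x hx
    exact hreal x hx
  · exact analyticAt_axial_of_vpart_ne_zero hX0 (hh _ hX) (hP _ trivial)

theorem analyticOnNhd_Ft (k : ℕ) (hU : IsOpen U) (hh : AnalyticOnNhd ℂ h U)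
    (hreal : ∀ x : ℝ, (x : ℂ) ∈ U → (h x).im = 0) (hP : AnalyticOnNhd ℝ P Set.univ) :
    AnalyticOnNhd ℝ (Ft k h P) (axialDomain m U) := fun X hX =>
  analyticAt_iterate_laplacian (analyticOnNhd_axial hU hh hreal hP X hX) _

theorem Ft_eq_radialPair (hU : IsOpen U) (hh : AnalyticOnNhd ℂ h U)
    (hP : IsHomogeneousMonogenic k P) (hX : X ∈ axialDomain m U) (hX0 : vpart X ≠ 0) :
    Ft k h P X = (∏ i ∈ Finset.range (k + (m - 1) / 2), (2 * (2 * k + m - 1 - 2 * i) : ℝ)) •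
      radialPair (sndDeriv^[k + (m - 1) / 2] (rePart h)) (sndDeriv^[k + (m - 1) / 2] (imPart h))
        P X := by
  rw [Ft, axial_eq_radialPair]
  exact (isVekuaPair_of_analyticOnNhd hh).iterate_laplacian_radialPair (isOpen_offAxisCoords hU)
    hP _ (radialCoords_mem_offAxisCoords_iff.2 ⟨hX0, hX⟩)

theorem cauchyRiemann_Ft_of_vpart_ne_zero (hm : Odd m) (hU : IsOpen U) (hh : AnalyticOnNhd ℂ h U)
    (hP : IsHomogeneousMonogenic k P) (hX : X ∈ axialDomain m U) (hX0 : vpart X ≠ 0) :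
    cauchyRiemann (Ft k h P) X = 0 := by
  have hcoords := radialCoords_mem_offAxisCoords_iff.2 ⟨hX0, hX⟩
  have near_X := (isOpen_radialCoords_preimage (isOpen_offAxisCoords hU)).mem_nhds hcoords
  have hFt := Filter.eventually_of_mem near_X fun Y hY =>
    (radialCoords_mem_offAxisCoords_iff.1 hY).elim fun hY0 hY => Ft_eq_radialPair hU hh hP hY hY0
  have hpair := (isVekuaPair_of_analyticOnNhd hh).iterate_sndDeriv (isOpen_offAxisCoords hU)
    (k + (m - 1) / 2)
  have hconst : (1 : ℝ) + 2 * (k + (m - 1) / 2 : ℕ) - (2 * k + m) = 0 := by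
    obtain ⟨p, rfl⟩ := hm
    rw [Nat.add_sub_cancel, Nat.mul_div_cancel_left p two_pos]
    push_cast
    ring
  rw [(cauchyRiemann_eventuallyEq hFt).eq_of_nhds, cauchyRiemann_const_smul,
    hpair.cauchyRiemann_radialPair hP hcoords, hconst, zero_smul, smul_zero]

theorem monogenicOn_Ft (hm : Odd m) (hU : IsOpen U) (hh : AnalyticOnNhd ℂ h U)
    (hreal : ∀ x : ℝ, (x : ℂ) ∈ U → (h x).im = 0) (hP : IsHomogeneousMonogenic k P) :
    MonogenicOn (Ft k h P) (axialDomain m U) := by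
  have : NeZero m := ⟨hm.pos.ne'⟩
  have hFt := analyticOnNhd_Ft k hU hh hreal fun x _ => hP.1.analyticAt x
  refine ⟨fun X hX => (hFt X hX).contDiffAt.contDiffWithinAt, ?_⟩
  have hcont : ContinuousOn (cauchyRiemann (Ft k h P)) (axialDomain m U) := fun X hX =>
    (analyticAt_cauchyRiemann (hFt X hX)).continuousAt.continuousWithinAt
  have hzero : Set.EqOn (cauchyRiemann (Ft k h P)) 0
      (axialDomain m U ∩ {X | vpart X ≠ 0}) := fun X hX =>
    cauchyRiemann_Ft_of_vpart_ne_zero hm hU hh hP hX.1 hX.2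
  exact hzero.of_subset_closure hcont continuousOn_const Set.inter_subset_left
    (dense_setOf_vpart_ne_zero.open_subset_closure_inter (isOpen_axialDomain hU))

end FueterTheorem

section Hyperplane

variable {h : ℂ → ℂ} {U : Set ℂ} {X : E (m + 1)}

theorem Ft_join_zero (hU : IsOpen U) (hh : AnalyticOnNhd ℂ h U) (hP : IsHomogeneousMonogenic k P)
    {φ : ℝ → ℝ} {x : E m} (hx : x ≠ 0) (hxU : join 0 x ∈ axialDomain m U)
    (hφ : ∀ᶠ s in 𝓝 (‖x‖ ^ 2), h ⟨0, √s⟩ = φ s) :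
    Ft k h P (join 0 x) =
      (∏ i ∈ Finset.range (k + (m - 1) / 2), (2 * (2 * k + m - 1 - 2 * i) : ℝ)) •
        iteratedDeriv (k + (m - 1) / 2) φ (‖x‖ ^ 2) • P x := by
  have hx0 : vpart (join 0 x) ≠ 0 := by rwa [vpart_join]
  have hpair := isVekuaPair_of_analyticOnNhd hh
  have hcoords := radialCoords_mem_offAxisCoords_iff.2 ⟨hx0, hxU⟩
  have radialCoords_join : radialCoords (join 0 x) = (0, ‖x‖ ^ 2) := by
    rw [radialCoords, vpart_join, join_apply_zero]
  have hre : (fun s => rePart h (0, s)) =ᶠ[𝓝 (‖x‖ ^ 2)] φ := by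
    filter_upwards [hφ] with s hs
    rw [rePart, halfPlanePoint, hs, Complex.ofReal_re]
  have him : (fun s => imPart h (0, s)) =ᶠ[𝓝 (‖x‖ ^ 2)] fun _ => 0 := by
    filter_upwards [hφ] with s hs
    rw [imPart, halfPlanePoint, hs, Complex.ofReal_im, zero_mul]
  rw [Ft_eq_radialPair hU hh hP hxU hx0, radialPair, radial, radial,
    iterate_sndDeriv_eq_iteratedDeriv (isOpen_offAxisCoords hU) hpair.analytic_left _ hcoords,
    iterate_sndDeriv_eq_iteratedDeriv (isOpen_offAxisCoords hU) hpair.analytic_right _ hcoords,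
    radialCoords_join, hre.iteratedDeriv_eq, him.iteratedDeriv_eq, iteratedDeriv_fun_const_zero,
    zero_smul, add_zero, vpart_join]

theorem iteratedDeriv_one_sub_rpow (β : ℝ) (n : ℕ) (s : ℝ) :
    iteratedDeriv n (fun s => (1 - s) ^ β) s =
      (-1) ^ n * (∏ i ∈ Finset.range n, (β - i)) * (1 - s) ^ (β - n) := by
  rw [congrFun (iteratedDeriv_comp_const_sub n (fun y : ℝ => y ^ β) 1) s,
    iteratedDeriv_eq_iterate, Real.iter_deriv_rpow_const,
    descPochhammer_eval_eq_prod_range, smul_eq_mul, mul_assoc]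

theorem prod_range_sub_eq_prod_Icc (α : ℝ) (N : ℕ) :
    ∏ i ∈ Finset.range N, (α + N - i) = ∏ j ∈ Finset.Icc 1 N, (α + (j : ℝ)) := by
  induction N generalizing α with
  | zero => simp
  | succ N ih =>
    rw [Finset.prod_range_succ', Finset.prod_Icc_succ_top (by lia), ← ih]
    push_cast
    congr 1
    · exact Finset.prod_congr rfl fun i _ => by ring
    · ring

theorem prod_range_four_mul_sub (N : ℕ) :
    ∏ i ∈ Finset.range N, (4 * (N - i) : ℝ) = 2 ^ N * (2 * N).doubleFactorial := by
  induction N with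
  | zero => simp
  | succ N ih =>
    rw [Finset.prod_range_succ', mul_add_one, Nat.doubleFactorial_add_two, pow_succ]
    simp only [Nat.cast_succ, add_sub_add_right_eq_sub, ih]
    push_cast
    ring

theorem prod_range_laplacian_factor (hm : Odd m) (k : ℕ) :
    ∏ i ∈ Finset.range (k + (m - 1) / 2), (2 * (2 * k + m - 1 - 2 * i) : ℝ) =
      2 ^ (k + (m - 1) / 2) * (2 * k + m - 1).doubleFactorial := by
  obtain ⟨p, rfl⟩ := hm
  rw [Nat.add_sub_cancel, Nat.mul_div_cancel_left p two_pos,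
    show 2 * k + (2 * p + 1) - 1 = 2 * (k + p) by lia, ← prod_range_four_mul_sub]
  refine Finset.prod_congr rfl fun i _ => ?_
  push_cast
  ring

end Hyperplane

section OnePlusSqPow

theorem one_add_sq_mem_slitPlane {z : ℂ} (hz : |z.im| < 1) : 1 + z ^ 2 ∈ Complex.slitPlane := by
  have him : z.im ^ 2 < 1 := (sq_lt_one_iff_abs_lt_one z.im).2 hz
  rw [Complex.mem_slitPlane_iff]
  simp only [Complex.add_re, Complex.one_re, Complex.add_im, Complex.one_im, pow_two,
    Complex.mul_re, Complex.mul_im]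
  by_cases hzero : z.re * z.im = 0
  · exact Or.inl (by nlinarith [sq_nonneg z.re])
  · exact Or.inr fun h => hzero (by linarith)

/-- The strip `|Im z| < 1`, on which the principal branch of `(1 + z²)^β` is holomorphic. -/
def unitStrip : Set ℂ := {z | |z.im| < 1}

theorem isOpen_unitStrip : IsOpen unitStrip :=
  isOpen_lt Complex.continuous_im.abs continuous_const

theorem axialDomain_unitStrip (m : ℕ) : axialDomain m unitStrip = {X | ‖vpart X‖ < 1} := by
  simp [axialDomain, unitStrip]

theorem analyticOnNhd_onePlusSqPow (β : ℝ) : AnalyticOnNhd ℂ (onePlusSqPow β) unitStrip :=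
  fun z hz => (by fun_prop : AnalyticAt ℂ (fun z : ℂ => 1 + z ^ 2) z).cpow analyticAt_const
    (one_add_sq_mem_slitPlane hz)

theorem onePlusSqPow_ofReal_im (β x : ℝ) : (onePlusSqPow β x).im = 0 := by
  have hpos : (1 + (x : ℂ) ^ 2) = ((1 + x ^ 2 : ℝ) : ℂ) := by push_cast; rfl
  rw [onePlusSqPow, hpos, ← Complex.ofReal_cpow (by positivity), Complex.ofReal_im]

theorem onePlusSqPow_sqrt_mul_I (β : ℝ) {s : ℝ} (hs₀ : 0 ≤ s) (hs₁ : s ≤ 1) :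
    onePlusSqPow β ⟨0, √s⟩ = ((1 - s) ^ β : ℝ) := by
  have hbase : (1 + (⟨0, √s⟩ : ℂ) ^ 2) = ((1 - s : ℝ) : ℂ) := by
    apply Complex.ext <;> simp [pow_two, Real.mul_self_sqrt hs₀, sub_eq_add_neg]
  rw [onePlusSqPow, hbase, ← Complex.ofReal_cpow (sub_nonneg.2 hs₁)]

theorem Ft_onePlusSqPow_join_zero_of_ne_zero (hm : Odd m) (α : ℝ)
    (hP : IsHomogeneousMonogenic k P) {x : E m} (hx : x ≠ 0) (hx1 : ‖x‖ < 1) :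
    Ft k (onePlusSqPow (α + (k + (m - 1) / 2 : ℕ))) P (join 0 x) =
      fueterConst m k α • weight α P x := by
  have hsq : ‖x‖ ^ 2 < 1 := (sq_lt_one_iff₀ (norm_nonneg x)).2 hx1
  have join_mem : join 0 x ∈ axialDomain m unitStrip := by
    rwa [axialDomain_unitStrip, Set.mem_ofPred_eq, vpart_join]
  have on_imaginary_axis : ∀ᶠ s in 𝓝 (‖x‖ ^ 2),
      onePlusSqPow (α + (k + (m - 1) / 2 : ℕ)) ⟨0, √s⟩ =
        ((1 - s) ^ (α + (k + (m - 1) / 2 : ℕ)) : ℝ) := by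
    filter_upwards [Ioo_mem_nhds (pow_pos (norm_pos_iff.2 hx) 2) hsq] with s hs
    exact onePlusSqPow_sqrt_mul_I _ hs.1.le hs.2.le
  rw [Ft_join_zero isOpen_unitStrip (analyticOnNhd_onePlusSqPow _) hP hx join_mem
    on_imaginary_axis, iteratedDeriv_one_sub_rpow, prod_range_sub_eq_prod_Icc,
    add_sub_cancel_right, prod_range_laplacian_factor hm, weight, smul_smul, smul_smul, fueterConst,
    show (-2 : ℝ) = -1 * 2 by norm_num, mul_pow]
  congr 1
  ring

theorem continuousAt_weight (α : ℝ) {x : E m} (hP : ContinuousAt P x) (hx : ‖x‖ < 1) :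
    ContinuousAt (weight α P) x := by
  have hbase : ContinuousAt (fun y : E m => 1 - ‖y‖ ^ 2) x := by fun_prop
  have hpos : 0 < 1 - ‖x‖ ^ 2 := sub_pos.2 ((sq_lt_one_iff₀ (norm_nonneg x)).2 hx)
  exact (hbase.rpow_const (Or.inl hpos.ne')).smul hP

theorem Ft_onePlusSqPow_join_zero (hm : Odd m) (α : ℝ) (hP : IsHomogeneousMonogenic k P)
    {x : E m} (hx1 : ‖x‖ < 1) :
    Ft k (onePlusSqPow (α + (k + (m - 1) / 2 : ℕ))) P (join 0 x) =
      fueterConst m k α • weight α P x := by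
  by_cases hx : x = 0
  · have : NeZero m := ⟨hm.pos.ne'⟩
    subst hx
    have join_mem : join 0 (0 : E m) ∈ axialDomain m unitStrip := by
      rwa [axialDomain_unitStrip, Set.mem_ofPred_eq, vpart_join]
    have hFt : ContinuousAt
        (fun x : E m => Ft k (onePlusSqPow (α + (k + (m - 1) / 2 : ℕ))) P (join 0 x)) 0 :=
      ContinuousAt.comp (g := Ft k (onePlusSqPow _) P)
        (analyticOnNhd_Ft k isOpen_unitStrip (analyticOnNhd_onePlusSqPow _)
          (fun x _ => onePlusSqPow_ofReal_im _ x) (fun x _ => hP.1.analyticAt x)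
          _ join_mem).continuousAt (continuous_join 0).continuousAt
    have hweight := (continuousAt_weight α (hP.1.analyticAt 0).continuousAt hx1).fun_const_smul
      (fueterConst m k α)
    refine tendsto_nhds_unique_of_eventuallyEq (l := 𝓝[≠] (0 : E m))
      (hFt.mono_left nhdsWithin_le_nhds) (hweight.mono_left nhdsWithin_le_nhds) ?_
    filter_upwards [self_mem_nhdsWithin, nhdsWithin_le_nhds (Metric.ball_mem_nhds 0 one_pos)]
      with y hy hy1
    exact Ft_onePlusSqPow_join_zero_of_ne_zero hm α hP hy (mem_ball_zero_iff.1 hy1)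
  · exact Ft_onePlusSqPow_join_zero_of_ne_zero hm α hP hx hx1

end OnePlusSqPow

section CauchyKowalevski

variable {F : E (m + 1) → Cl m} {Ω : Set (E (m + 1))}

theorem cauchyRiemann_fderiv_apply {X : E (m + 1)} (hF : ContDiffAt ℝ 2 F X)
    (hCR : cauchyRiemann F =ᶠ[𝓝 X] 0) (v : E (m + 1)) :
    cauchyRiemann (fun Y => fderiv ℝ F Y v) X = 0 := by
  have hF' : DifferentiableAt ℝ (fderiv ℝ F) X :=
    (hF.fderiv_right (m := 1) le_rfl).differentiableAt one_ne_zero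
  have second_partial (w : E (m + 1)) :
      fderiv ℝ (fun Y => fderiv ℝ F Y v) X w = fderiv ℝ (fderiv ℝ F) X v w := by
    rw [(hF'.hasFDerivAt.clm_apply (hasFDerivAt_const v X)).fderiv]
    simpa using hF.isSymmSndFDerivAt (by simp [minSmoothness_of_isRCLikeNormedField]) w v
  rw [cauchyRiemann]
  simp_rw [second_partial]
  rw [← fderiv_cauchyRiemann hF, hCR.fderiv_eq]
  simp

theorem iteratedDeriv_comp_join (hΩ : IsOpen Ω) (hF : AnalyticOnNhd ℝ F Ω)
    (hCR : ∀ X ∈ Ω, cauchyRiemann F X = 0) (n : ℕ) {t : ℝ} {x : E m} (hx : join t x ∈ Ω) :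
    iteratedDeriv n (fun s => F (join s x)) t =
      (-1 : ℝ) ^ n • dirac^[n] (fun y => F (join t y)) x := by
  induction n generalizing F with
  | zero => simp
  | succ n ih =>
    set F' : E (m + 1) → Cl m := fun Y => fderiv ℝ F Y (EuclideanSpace.single 0 1)
    have hF' : AnalyticOnNhd ℝ F' Ω := fun Y hY => analyticAt_fderiv_apply (hF Y hY) _
    have hCR' (Y : E (m + 1)) (hY : Y ∈ Ω) : cauchyRiemann F' Y = 0 :=
      cauchyRiemann_fderiv_apply (hF Y hY).contDiffAt
        ((hΩ.eventually_mem hY).mono fun Z hZ => hCR Z hZ) _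
    have deriv_eq : deriv (fun s => F (join s x)) =ᶠ[𝓝 t] fun s => F' (join s x) := by
      have stays_in : ∀ᶠ s in 𝓝 t, join s x ∈ Ω :=
        (analyticAt_join_left t x).continuousAt.eventually_mem (hΩ.mem_nhds hx)
      exact stays_in.mono fun s hs => by simpa using deriv_comp_join (hF _ hs).differentiableAt
    have eq_neg_dirac :
        (fun y => F' (join t y)) =ᶠ[𝓝 x] fun y => (-1 : ℝ) • dirac (fun z => F (join t z)) y := by
      have stays_in : ∀ᶠ y in 𝓝 x, join t y ∈ Ω :=
        (continuous_join t).continuousAt.eventually_mem (hΩ.mem_nhds hx)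
      filter_upwards [stays_in] with y hy
      have dirac_eq := dirac_comp_join (hF _ hy).differentiableAt
      rw [join_apply_zero, vpart_join] at dirac_eq
      rw [dirac_eq, neg_one_smul]
      exact eq_neg_of_add_eq_zero_left (hCR _ hy)
    rw [iteratedDeriv_succ', deriv_eq.iteratedDeriv_eq n, ih hF' hCR',
      (iterate_dirac_eventuallyEq eq_neg_dirac n).eq_of_nhds, iterate_dirac_const_smul, smul_smul,
      ← pow_succ, Function.iterate_succ_apply]

theorem hasSum_taylor_of_summable {V : Type*} [NormedAddCommGroup V] [NormedSpace ℝ V]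
    [CompleteSpace V] {f : ℝ → V} {R : ℝ} (hf : AnalyticOnNhd ℝ f (Metric.ball 0 R))
    (hs : ∀ t ∈ Metric.ball 0 R,
      Summable fun n : ℕ => (t ^ n / (n.factorial : ℝ)) • iteratedDeriv n f 0)
    {t : ℝ} (ht : t ∈ Metric.ball 0 R) :
    HasSum (fun n : ℕ => (t ^ n / (n.factorial : ℝ)) • iteratedDeriv n f 0) (f t) := by
  obtain ⟨r, htr, hrR⟩ := exists_between (mem_ball_zero_iff.1 ht)
  have hr0 : 0 < r := (norm_nonneg t).trans_lt htr
  obtain ⟨p, r₀, hp⟩ := hf 0 (Metric.mem_ball_self (hr0.trans hrR))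
  have taylor_term (s : ℝ) (n : ℕ) :
      (s ^ n / (n.factorial : ℝ)) • iteratedDeriv n f 0 = s ^ n • p.coeff n := by
    rw [iteratedDeriv_eq_iteratedFDeriv, ← hp.factorial_smul (1 : ℝ) n, ← Nat.cast_smul_eq_nsmul ℝ,
      smul_smul, div_mul_cancel₀ _ (by positivity)]
    rfl
  simp_rw [taylor_term] at hs ⊢
  have radius_ge : ENNReal.ofReal r ≤ p.radius := by
    have terms_tendsto := (hs r (by simpa [abs_of_pos hr0])).tendsto_atTop_zero.norm
    rw [norm_zero] at terms_tendsto
    refine p.le_radius_of_tendsto (r := r.toNNReal) (l := 0) (terms_tendsto.congr fun n => ?_)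
    rw [norm_smul, norm_pow, Real.norm_of_nonneg hr0.le, mul_comm, Real.coe_toNNReal _ hr0.le,
      ← p.norm_apply_eq_norm_coef]
  have hsum := p.hasFPowerSeriesOnBall ((ENNReal.ofReal_pos.2 hr0).trans_le radius_ge)
  have ball_subset : Metric.ball (0 : ℝ) r ⊆ Metric.eball 0 p.radius := by
    rw [← Metric.eball_ofReal]
    exact Metric.eball_subset_eball radius_ge
  have agree_near_zero : f =ᶠ[𝓝 0] p.sum := by
    filter_upwards [hasFPowerSeriesAt_iff.1 hp.hasFPowerSeriesAt,
      hasFPowerSeriesAt_iff.1 hsum.hasFPowerSeriesAt] with z hfz hpz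
    simpa using hfz.unique hpz
  have agree : Set.EqOn f p.sum (Metric.ball 0 r) :=
    AnalyticOnNhd.eqOn_of_preconnected_of_eventuallyEq
      (hf.mono (Metric.ball_subset_ball hrR.le))
      (fun s hs => hsum.analyticAt_of_mem (ball_subset hs)) (convex_ball 0 r).isPreconnected
      (Metric.mem_ball_self hr0) agree_near_zero
  have htr' : t ∈ Metric.ball (0 : ℝ) r := mem_ball_zero_iff.2 htr
  simpa [agree htr'] using hsum.hasSum (ball_subset htr')

theorem ckTerm_const_smul (c : ℝ) (g : E m → Cl m) (X : E (m + 1)) (n : ℕ) :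
    ckTerm (fun y => c • g y) X n = c • ckTerm g X n := by
  rw [ckTerm, iterate_dirac_const_smul, smul_comm, ckTerm]

theorem CK_const_smul (c : ℝ) (g : E m → Cl m) (X : E (m + 1)) :
    CK (fun y => c • g y) X = c • CK g X := by
  simp_rw [CK, ckTerm_const_smul, tsum_const_smul'']

theorem eq_CK_of_cauchyRiemann_eq_zero (hΩ : IsOpen Ω) (hF : AnalyticOnNhd ℝ F Ω)
    (hCR : ∀ X ∈ Ω, cauchyRiemann F X = 0) {g : E m → Cl m} {x : E m} {R : ℝ}
    (hg : (fun y => F (join 0 y)) =ᶠ[𝓝 x] g) (hmem : ∀ t ∈ Metric.ball 0 R, join t x ∈ Ω)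
    (hs : ∀ t ∈ Metric.ball 0 R, Summable (ckTerm g (join t x))) {t : ℝ}
    (ht : t ∈ Metric.ball 0 R) : F (join t x) = CK g (join t x) := by
  have h0 : join 0 x ∈ Ω := hmem 0 (Metric.mem_ball_self (Metric.pos_of_mem_ball ht))
  have taylor_term (s : ℝ) (n : ℕ) :
      (s ^ n / (n.factorial : ℝ)) • iteratedDeriv n (fun s => F (join s x)) 0 =
        ckTerm g (join s x) n := by
    rw [iteratedDeriv_comp_join hΩ hF hCR n h0, (iterate_dirac_eventuallyEq hg n).eq_of_nhds,
      ckTerm, smul_smul, vpart_join, join_apply_zero, neg_pow s]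
    congr 1
    ring
  have analytic : AnalyticOnNhd ℝ (fun s => F (join s x)) (Metric.ball 0 R) := fun s hs =>
    (hF _ (hmem s hs)).comp_of_eq (analyticAt_join_left s x) rfl
  have taylor := hasSum_taylor_of_summable analytic (by simpa only [taylor_term] using hs) ht
  simp_rw [taylor_term] at taylor
  exact taylor.tsum_eq.symm

end CauchyKowalevski

section VectorPowers

/-- The factor `μ` in `∂ (x^{l+1} P) = -μ x^l P`, where `d = 2k + m` for a homogeneous monogenic
polynomial `P` of degree `k` in `ℝ^m`. -/
def diracFactor (d l : ℕ) : ℕ := if Even l then l + d else l + 1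

theorem diracFactor_le (d l : ℕ) : diracFactor d l ≤ l + 1 + d := by
  unfold diracFactor
  split_ifs <;> omega

theorem IsHomogeneousMonogenic.dirac_vec_pow_succ_mul (hP : IsHomogeneousMonogenic k P) (l : ℕ)
    (x : E m) :
    dirac (fun y => vec y ^ (l + 1) * P y) x =
      (-(diracFactor (2 * k + m) l : ℝ)) • (vec x ^ l * P x) := by
  have vec_pow_even (y : E m) (n : ℕ) (a : Cl m) :
      vec y ^ (2 * n) * a = ((-1) ^ n * (‖y‖ ^ 2) ^ n) • a := by
    rw [vec_pow_two_mul, neg_pow, Algebra.smul_def]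
  have radial_deriv (n : ℕ) (s : ℝ) :
      HasDerivAt (fun s : ℝ => (-1) ^ n * s ^ n) ((-1) ^ n * (n * s ^ (n - 1))) s :=
    (hasDerivAt_pow n s).const_mul _
  obtain ⟨n, rfl | rfl⟩ := l.even_or_odd'
  · have hvecP : DifferentiableAt ℝ (fun y => vec y * P y) x :=
      (vecCLM m).differentiableAt.mul (hP.1.differentiableAt x)
    simp_rw [pow_succ, mul_assoc, vec_pow_even]
    rw [dirac_radial_smul (radial_deriv n _) hvecP, vec_mul_vec_mul, hP.dirac_vec_mul, diracFactor,
      if_pos (even_two_mul n), smul_smul, smul_smul, smul_smul, ← add_smul]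
    congr 1
    push_cast
    rcases n with _ | n
    · simp
    · rw [Nat.add_sub_cancel, pow_succ (‖x‖ ^ 2)]
      push_cast
      ring
  · have even_exponent : 2 * n + 1 + 1 = 2 * (n + 1) := by ring
    simp_rw [even_exponent, vec_pow_even]
    rw [dirac_radial_smul (radial_deriv (n + 1) _) (hP.1.differentiableAt x), hP.2, smul_zero,
      add_zero, pow_succ (vec x), mul_assoc, vec_pow_even, diracFactor,
      if_neg (Nat.not_even_two_mul_add_one n), smul_smul, Nat.add_sub_cancel]
    congr 1
    push_cast
    ring

theorem norm_fderiv_vec_pow_le (x : E m) (l : ℕ) :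
    ‖fderiv ℝ (fun y : E m => vec y ^ l) x‖ ≤
      l * ((‖(1 : Cl m)‖ + ‖vecCLM m‖ * ‖(1 : Cl m)‖) ^ 2 * ‖vecCLM m‖ * ‖x‖ ^ (l - 1)) := by
  set K := ‖(1 : Cl m)‖ + ‖vecCLM m‖ * ‖(1 : Cl m)‖
  have power_rule (v : E m) : fderiv ℝ (fun y : E m => vec y ^ l) x v =
      ∑ i ∈ Finset.range l, vec x ^ (l - 1 - i) * vec v * vec x ^ i := by
    rw [← coe_vecCLM, fderiv_fun_pow' l (vecCLM m).differentiableAt]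
    simp
  have summand_bound (v : E m) (i : ℕ) (hi : i ∈ Finset.range l) :
      ‖vec x ^ (l - 1 - i) * vec v * vec x ^ i‖ ≤
        K ^ 2 * ‖vecCLM m‖ * ‖x‖ ^ (l - 1) * ‖v‖ := by
    have split_exponent : ‖x‖ ^ (l - 1) = ‖x‖ ^ (l - 1 - i) * ‖x‖ ^ i := by
      have := Finset.mem_range.1 hi
      rw [← pow_add, Nat.sub_add_cancel (by omega)]
    calc ‖vec x ^ (l - 1 - i) * vec v * vec x ^ i‖
        ≤ ‖vec x ^ (l - 1 - i)‖ * ‖vec v‖ * ‖vec x ^ i‖ := norm_mul₃_le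
      _ ≤ (K * ‖x‖ ^ (l - 1 - i)) * (‖vecCLM m‖ * ‖v‖) * (K * ‖x‖ ^ i) := by
          gcongr
          · exact norm_vec_pow_le _ _
          · exact (vecCLM m).le_opNorm v
          · exact norm_vec_pow_le _ _
      _ = K ^ 2 * ‖vecCLM m‖ * ‖x‖ ^ (l - 1) * ‖v‖ := by
          rw [split_exponent]
          ring
  refine ContinuousLinearMap.opNorm_le_bound _ (by positivity) fun v => ?_
  rw [power_rule]
  simpa [mul_assoc] using norm_sum_le_of_le _ (summand_bound v)

theorem exists_norm_fderiv_vec_pow_mul_le (hP : ContDiff ℝ 1 P) (ρ : ℝ) :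
    ∃ C : ℝ, ∀ l : ℕ, ∀ x ∈ Metric.ball (0 : E m) ρ,
      ‖fderiv ℝ (fun y => vec y ^ l * P y) x‖ ≤ C * (l * ρ ^ (l - 1) + ρ ^ l) := by
  obtain ⟨A, hA⟩ := (isCompact_closedBall (0 : E m) ρ).exists_bound_of_continuousOn
    hP.continuous.continuousOn
  obtain ⟨B, hB⟩ := (isCompact_closedBall (0 : E m) ρ).exists_bound_of_continuousOn
    (hP.continuous_fderiv one_ne_zero).continuousOn
  set K := ‖(1 : Cl m)‖ + ‖vecCLM m‖ * ‖(1 : Cl m)‖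
  refine ⟨A * (K ^ 2 * ‖vecCLM m‖) + K * B, fun l x hx => ?_⟩
  have hxρ : ‖x‖ ≤ ρ := (mem_ball_zero_iff.1 hx).le
  have hρ : 0 ≤ ρ := (norm_nonneg x).trans hxρ
  have hPx := hA x (Metric.ball_subset_closedBall hx)
  have hDPx := hB x (Metric.ball_subset_closedBall hx)
  have hA0 : 0 ≤ A := (norm_nonneg _).trans hPx
  have hB0 : 0 ≤ B := (norm_nonneg _).trans hDPx
  have hpow : DifferentiableAt ℝ (fun y : E m => vec y ^ l) x :=
    (vecCLM m).differentiableAt.pow l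
  have product_rule (v : E m) : fderiv ℝ (fun y => vec y ^ l * P y) x v =
      vec x ^ l * fderiv ℝ P x v + fderiv ℝ (fun y : E m => vec y ^ l) x v * P x := by
    rw [fderiv_fun_mul' hpow (hP.differentiable one_ne_zero x)]
    simp
  calc ‖fderiv ℝ (fun y => vec y ^ l * P y) x‖
      ≤ ‖vec x ^ l‖ * ‖fderiv ℝ P x‖ + ‖fderiv ℝ (fun y : E m => vec y ^ l) x‖ * ‖P x‖ := by
        refine ContinuousLinearMap.opNorm_le_bound _ (by positivity) fun v => ?_
        rw [product_rule, add_mul, mul_assoc, mul_right_comm]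
        refine (norm_add_le _ _).trans (add_le_add ?_ ?_) <;>
        · refine (norm_mul_le _ _).trans ?_
          gcongr
          exact ContinuousLinearMap.le_opNorm _ v
    _ ≤ (K * ρ ^ l) * B + (l * (K ^ 2 * ‖vecCLM m‖ * ρ ^ (l - 1))) * A := by
        gcongr
        · exact (norm_vec_pow_le x l).trans (by gcongr)
        · exact (norm_fderiv_vec_pow_le x l).trans (by gcongr)
    _ ≤ (A * (K ^ 2 * ‖vecCLM m‖) + K * B) * (l * ρ ^ (l - 1) + ρ ^ l) := by
        have cross_nonneg : 0 ≤ A * (K ^ 2 * ‖vecCLM m‖) * ρ ^ l + K * B * (l * ρ ^ (l - 1)) := by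
          positivity
        linarith

end VectorPowers

section CoefficientSequences

variable {R : ℝ} {b : ℕ → ℝ}

/-- The power series with coefficients `b` converges absolutely in the open disk of radius `R`. -/
def SummableOnDisk (R : ℝ) (b : ℕ → ℝ) : Prop :=
  ∀ ρ, 0 ≤ ρ → ρ < R → Summable fun l => |b l| * ρ ^ l

/-- The coefficients of `∂ (∑_l b_l x^l P)`, where `d = 2k + m` for a homogeneous monogenic
polynomial `P` of degree `k` in `ℝ^m`. -/
def diracCoeff (d : ℕ) (b : ℕ → ℝ) (l : ℕ) : ℝ := -(diracFactor d l : ℝ) * b (l + 1)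

theorem SummableOnDisk.summable_choose_mul (hb : SummableOnDisk R b) (d : ℕ) {t ρ : ℝ}
    (ht : 0 ≤ t) (hρ : 0 < ρ) (hlt : t + ρ < R) :
    Summable fun q : ℕ × ℕ =>
      ((q.2 + d + q.1).choose q.1 : ℝ) * |b (q.2 + q.1)| * (t ^ q.1 * ρ ^ q.2) := by
  have binomial (N : ℕ) : HasSum
      (fun n => |b N| * (t ^ n * ρ ^ (N + d - n) * ((N + d).choose n : ℝ)))
      (|b N| * (t + ρ) ^ (N + d)) := by
    rw [add_pow]
    refine (hasSum_sum_of_ne_finset_zero fun n hn => ?_).mul_left _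
    rw [Nat.choose_eq_zero_of_lt (by simpa using hn), Nat.cast_zero, mul_zero]
  have expanded : Summable fun q : ℕ × ℕ =>
      |b q.1| * (t ^ q.2 * ρ ^ (q.1 + d - q.2) * ((q.1 + d).choose q.2 : ℝ)) := by
    refine (summable_prod_of_nonneg fun q => by positivity).2
      ⟨fun N => (binomial N).summable, ?_⟩
    simp_rw [(binomial _).tsum_eq, pow_add, ← mul_assoc]
    exact (hb (t + ρ) (by positivity) hlt).mul_right _
  have injective : Function.Injective fun q : ℕ × ℕ => (q.2 + q.1, q.1) := by
    rintro ⟨n, l⟩ ⟨n', l'⟩ h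
    simp only [Prod.mk.injEq] at h ⊢
    omega
  refine ((expanded.comp_injective injective).mul_right (ρ ^ d)⁻¹).congr fun q => ?_
  have exponent : q.2 + q.1 + d - q.1 = q.2 + d := by omega
  rw [Function.comp_apply, exponent, add_right_comm q.2 d q.1, pow_add]
  field_simp

theorem SummableOnDisk.summable_succ_add_mul (hb : SummableOnDisk R b) (d : ℕ) {ρ : ℝ}
    (hρ : 0 ≤ ρ) (hlt : ρ < R) :
    Summable fun l : ℕ => ((l : ℝ) + 1 + d) * |b (l + 1)| * ρ ^ l := by
  obtain ⟨σ, hρσ, hσR⟩ := exists_between hlt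
  obtain ⟨t, ht, htR⟩ := exists_between (sub_pos.2 hσR)
  have hσ : 0 < σ := hρ.trans_lt hρσ
  have column : Summable fun l : ℕ =>
      ((l + d + 1).choose 1 : ℝ) * |b (l + 1)| * (t ^ 1 * σ ^ l) :=
    (hb.summable_choose_mul d ht.le hσ (by linarith)).prod_factor 1
  refine (column.mul_right t⁻¹).of_nonneg_of_le (fun l => by positivity) fun l => ?_
  calc ((l : ℝ) + 1 + d) * |b (l + 1)| * ρ ^ l ≤ ((l : ℝ) + 1 + d) * |b (l + 1)| * σ ^ l := by
        gcongr
    _ = ((l + d + 1).choose 1 : ℝ) * |b (l + 1)| * (t ^ 1 * σ ^ l) * t⁻¹ := by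
        rw [Nat.choose_one_right, pow_one]
        push_cast
        field_simp
        ring

theorem SummableOnDisk.diracCoeff (hb : SummableOnDisk R b) (d : ℕ) :
    SummableOnDisk R (diracCoeff d b) := fun ρ hρ hlt => by
  refine (hb.summable_succ_add_mul d hρ hlt).of_nonneg_of_le (fun l => by positivity) fun l => ?_
  rw [CliffordFueter.diracCoeff, abs_mul, abs_neg, Nat.abs_cast]
  gcongr
  exact_mod_cast diracFactor_le d l

theorem abs_iterate_diracCoeff_le (d : ℕ) (b : ℕ → ℝ) (n l : ℕ) :
    |(diracCoeff d)^[n] b l| ≤ ((l + d + 1).ascFactorial n : ℝ) * |b (l + n)| := by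
  induction n generalizing b with
  | zero => simp
  | succ n ih =>
    calc |(diracCoeff d)^[n + 1] b l|
        ≤ ((l + d + 1).ascFactorial n : ℝ) * |diracCoeff d b (l + n)| := by
          rw [Function.iterate_succ_apply]
          exact ih _
      _ ≤ ((l + d + 1).ascFactorial n : ℝ) * ((l + d + 1 + n : ℕ) * |b (l + n + 1)|) := by
          rw [diracCoeff, abs_mul, abs_neg, Nat.abs_cast]
          gcongr
          have := diracFactor_le d (l + n)
          omega
      _ = ((l + d + 1).ascFactorial (n + 1) : ℝ) * |b (l + (n + 1))| := by
          rw [Nat.ascFactorial_succ, ← add_assoc l n 1]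
          push_cast
          ring

end CoefficientSequences

section CliffordSeries

theorem dirac_tsum {f : ℕ → E m → Cl m} {s : Set (E m)} {u : ℕ → ℝ} {x : E m} (hu : Summable u)
    (hs : IsOpen s) (hs' : IsPreconnected s) (hf : ∀ l, ∀ y ∈ s, DifferentiableAt ℝ (f l) y)
    (hbound : ∀ l, ∀ y ∈ s, ‖fderiv ℝ (f l) y‖ ≤ u l) (hx : x ∈ s)
    (hfx : Summable fun l => f l x) :
    dirac (fun y => ∑' l, f l y) x = ∑' l, dirac (f l) x := by
  have derivative : HasFDerivAt (fun y => ∑' l, f l y) (∑' l, fderiv ℝ (f l) x) x :=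
    hasFDerivAt_tsum_of_isPreconnected hu hs hs' (fun l y hy => (hf l y hy).hasFDerivAt) hbound hx
      hfx hx
  have summable_fderiv : Summable fun l => fderiv ℝ (f l) x :=
    hu.of_norm_bounded fun l => hbound l x hx
  have hasSum_partial (v : E m) :
      HasSum (fun l => fderiv ℝ (f l) x v) ((∑' l, fderiv ℝ (f l) x) v) :=
    summable_fderiv.hasSum.mapL (ContinuousLinearMap.apply ℝ (Cl m) v)
  rw [dirac, derivative.fderiv]
  exact (hasSum_sum fun j _ => (hasSum_partial _).mul_left (gen j)).tsum_eq.symm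

variable {R : ℝ} {b : ℕ → ℝ} {x : E m}

/-- The function `∑_l b_l x^l P(x)`, a power series in the vector variable `x` multiplied by `P`. -/
def cliffordSeries (P : E m → Cl m) (b : ℕ → ℝ) (x : E m) : Cl m := ∑' l, b l • (vec x ^ l * P x)

theorem norm_smul_vec_pow_mul_le (P : E m → Cl m) (b : ℕ → ℝ) (x : E m) (l : ℕ) :
    ‖b l • (vec x ^ l * P x)‖ ≤
      (‖(1 : Cl m)‖ + ‖vecCLM m‖ * ‖(1 : Cl m)‖) * ‖P x‖ * (|b l| * ‖x‖ ^ l) := by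
  calc ‖b l • (vec x ^ l * P x)‖ ≤ |b l| * (‖vec x ^ l‖ * ‖P x‖) := by
        rw [norm_smul, Real.norm_eq_abs]
        gcongr
        exact norm_mul_le _ _
    _ ≤ |b l| * ((‖(1 : Cl m)‖ + ‖vecCLM m‖ * ‖(1 : Cl m)‖) * ‖x‖ ^ l * ‖P x‖) := by
        gcongr
        exact norm_vec_pow_le x l
    _ = _ := by ring

theorem SummableOnDisk.summable_smul_vec_pow_mul (hb : SummableOnDisk R b) (P : E m → Cl m)
    (hx : ‖x‖ < R) : Summable fun l => b l • (vec x ^ l * P x) :=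
  ((hb _ (norm_nonneg x) hx).mul_left _).of_norm_bounded (norm_smul_vec_pow_mul_le P b x)

theorem SummableOnDisk.summable_deriv_add (hb : SummableOnDisk R b) {ρ : ℝ} (hρ : 0 ≤ ρ)
    (hlt : ρ < R) : Summable fun l : ℕ => |b l| * (l * ρ ^ (l - 1) + ρ ^ l) := by
  have derivative : Summable fun l : ℕ => |b l| * (l * ρ ^ (l - 1)) := by
    refine (summable_nat_add_iff 1).1 ((hb.summable_succ_add_mul 0 hρ hlt).congr fun l => ?_)
    rw [Nat.add_sub_cancel]
    push_cast
    ring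
  simpa only [mul_add] using derivative.add (hb ρ hρ hlt)

theorem dirac_cliffordSeries (hP : IsHomogeneousMonogenic k P) (hb : SummableOnDisk R b)
    (hx : ‖x‖ < R) :
    dirac (cliffordSeries P b) x = cliffordSeries P (diracCoeff (2 * k + m) b) x := by
  obtain ⟨ρ, hxρ, hρR⟩ := exists_between hx
  obtain ⟨C, hC⟩ := exists_norm_fderiv_vec_pow_mul_le
    (contDiff_iff_contDiffAt.2 fun y => (hP.1.analyticAt y).contDiffAt) ρ
  have differentiable (l : ℕ) (y : E m) : DifferentiableAt ℝ (fun y => vec y ^ l * P y) y :=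
    ((vecCLM m).differentiableAt.pow l).mul (hP.1.differentiableAt y)
  have fderiv_bound (l : ℕ) (y : E m) (hy : y ∈ Metric.ball 0 ρ) :
      ‖fderiv ℝ (fun y => b l • (vec y ^ l * P y)) y‖ ≤
        C * (|b l| * (l * ρ ^ (l - 1) + ρ ^ l)) := by
    rw [fderiv_fun_const_smul (differentiable l y), norm_smul, Real.norm_eq_abs, mul_left_comm]
    gcongr
    exact hC l y hy
  have hρ : 0 ≤ ρ := (norm_nonneg x).trans hxρ.le
  have dirac_term_zero : dirac (fun y => b 0 • (vec y ^ 0 * P y)) x = 0 := by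
    simp only [pow_zero, one_mul, dirac_const_smul, hP.2, smul_zero]
  have dirac_term_succ (l : ℕ) : dirac (fun y => b (l + 1) • (vec y ^ (l + 1) * P y)) x =
      diracCoeff (2 * k + m) b l • (vec x ^ l * P x) := by
    simp only [dirac_const_smul, hP.dirac_vec_pow_succ_mul, smul_smul, diracCoeff, mul_comm]
  have dirac_terms : Summable fun l => dirac (fun y => b l • (vec y ^ l * P y)) x := by
    refine (summable_nat_add_iff 1).1 ?_
    simpa only [dirac_term_succ] using (hb.diracCoeff (2 * k + m)).summable_smul_vec_pow_mul P hx
  calc dirac (cliffordSeries P b) x = ∑' l, dirac (fun y => b l • (vec y ^ l * P y)) x :=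
        dirac_tsum ((hb.summable_deriv_add hρ hρR).mul_left C) Metric.isOpen_ball
          (convex_ball _ _).isPreconnected (fun l y _ => (differentiable l y).fun_const_smul _)
          fderiv_bound (mem_ball_zero_iff.2 hxρ) (hb.summable_smul_vec_pow_mul P hx)
    _ = cliffordSeries P (diracCoeff (2 * k + m) b) x := by
        rw [dirac_terms.tsum_eq_zero_add, dirac_term_zero, zero_add]
        exact tsum_congr dirac_term_succ

theorem iterate_dirac_cliffordSeries (hP : IsHomogeneousMonogenic k P) (hb : SummableOnDisk R b)
    (n : ℕ) (hx : ‖x‖ < R) :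
    dirac^[n] (cliffordSeries P b) x = cliffordSeries P ((diracCoeff (2 * k + m))^[n] b) x := by
  induction n generalizing b with
  | zero => rfl
  | succ n ih =>
    have dirac_eq : dirac (cliffordSeries P b) =ᶠ[𝓝 x]
        cliffordSeries P (diracCoeff (2 * k + m) b) := by
      filter_upwards [continuous_norm.continuousAt.eventually_lt_const hx] with y hy
      exact dirac_cliffordSeries hP hb hy
    rw [Function.iterate_succ_apply, Function.iterate_succ_apply,
      (iterate_dirac_eventuallyEq dirac_eq n).eq_of_nhds, ih (hb.diracCoeff _)]

theorem summable_ckTerm_cliffordSeries (hP : IsHomogeneousMonogenic k P)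
    (hb : SummableOnDisk R b) {X : E (m + 1)} (hX : |X 0| + ‖vpart X‖ < R) :
    Summable (ckTerm (cliffordSeries P b) X) := by
  obtain ⟨ρ, hxρ, hρR⟩ := exists_between (lt_sub_iff_add_lt'.2 hX)
  have hρ : 0 < ρ := (norm_nonneg _).trans_lt hxρ
  have hx : ‖vpart X‖ < R := by linarith [abs_nonneg (X 0)]
  set K := (‖(1 : Cl m)‖ + ‖vecCLM m‖ * ‖(1 : Cl m)‖) * ‖P (vpart X)‖
  have double_series := (hb.summable_choose_mul (2 * k + m) (abs_nonneg (X 0)) hρ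
    (lt_sub_iff_add_lt'.1 hρR)).mul_left K
  have term_bound (n l : ℕ) :
      ‖((-X 0) ^ n / (n.factorial : ℝ)) •
        ((diracCoeff (2 * k + m))^[n] b l • (vec (vpart X) ^ l * P (vpart X)))‖ ≤
      K * (((l + (2 * k + m) + n).choose n : ℝ) * |b (l + n)| * (|X 0| ^ n * ρ ^ l)) := by
    calc _ ≤ |X 0| ^ n / n.factorial * (K * (|(diracCoeff (2 * k + m))^[n] b l| *
            ‖vpart X‖ ^ l)) := by
          rw [norm_smul, norm_div, norm_pow, norm_neg, RCLike.norm_natCast, Real.norm_eq_abs]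
          gcongr
          exact norm_smul_vec_pow_mul_le _ _ _ _
      _ ≤ |X 0| ^ n / n.factorial * (K * (((l + (2 * k + m) + 1).ascFactorial n : ℝ) *
            |b (l + n)| * ρ ^ l)) := by
          gcongr
          exact abs_iterate_diracCoeff_le _ _ _ _
      _ = _ := by
          rw [Nat.ascFactorial_eq_factorial_mul_choose]
          push_cast
          field_simp
  refine Summable.of_norm_bounded double_series.prod fun n => ?_
  rw [ckTerm, iterate_dirac_cliffordSeries hP hb n hx, cliffordSeries, ← tsum_const_smul'']
  exact tsum_of_norm_bounded (double_series.prod_factor n).hasSum (term_bound n)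

end CliffordSeries

section Weight

/-- The Taylor coefficients of `(1 + z²)^α` at `0`. -/
def onePlusSqPowCoeff (α : ℝ) (l : ℕ) : ℝ := if Even l then Ring.choose α (l / 2) else 0

theorem onePlusSqPowCoeff_two_mul (α : ℝ) (n : ℕ) :
    onePlusSqPowCoeff α (2 * n) = Ring.choose α n := by
  rw [onePlusSqPowCoeff, if_pos (even_two_mul n), Nat.mul_div_cancel_left n two_pos]

theorem onePlusSqPowCoeff_two_mul_add_one (α : ℝ) (n : ℕ) :
    onePlusSqPowCoeff α (2 * n + 1) = 0 :=
  if_neg (Nat.not_even_two_mul_add_one n)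

theorem summableOnDisk_ringChoose (α : ℝ) : SummableOnDisk 1 fun n => Ring.choose α n :=
    fun ρ hρ hlt => by
  lift ρ to NNReal using hρ
  have radius : (ρ : ENNReal) < (binomialSeries ℝ α).radius :=
    lt_of_lt_of_le (by exact_mod_cast hlt) Real.one_add_rpow_hasFPowerSeriesOnBall_zero.r_le
  refine ((binomialSeries ℝ α).summable_norm_mul_pow radius).congr fun n => ?_
  rw [binomialSeries, FormalMultilinearSeries.ofScalars_norm, Real.norm_eq_abs]

theorem hasSum_ringChoose_mul_pow (α : ℝ) {s : ℝ} (hs : |s| < 1) :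
    HasSum (fun n => Ring.choose α n * s ^ n) ((1 + s) ^ α) := by
  have mem : s ∈ Metric.eball (0 : ℝ) 1 := by
    rw [← ENNReal.ofReal_one, Metric.eball_ofReal]
    simpa using hs
  simpa [binomialSeries, FormalMultilinearSeries.ofScalars_apply_eq, mul_comm] using
    Real.one_add_rpow_hasFPowerSeriesOnBall_zero.hasSum mem

theorem summableOnDisk_onePlusSqPowCoeff (α : ℝ) : SummableOnDisk 1 (onePlusSqPowCoeff α) :=
    fun ρ hρ hlt => by
  have even_part : Summable fun n => |onePlusSqPowCoeff α (2 * n)| * ρ ^ (2 * n) := by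
    simpa only [onePlusSqPowCoeff_two_mul, pow_mul] using
      summableOnDisk_ringChoose α (ρ ^ 2) (sq_nonneg ρ) (by nlinarith)
  have odd_part : Summable fun n => |onePlusSqPowCoeff α (2 * n + 1)| * ρ ^ (2 * n + 1) := by
    simpa only [onePlusSqPowCoeff_two_mul_add_one, abs_zero, zero_mul] using summable_zero
  exact even_part.even_add_odd odd_part

theorem weight_eq_cliffordSeries (α : ℝ) (P : E m → Cl m) {x : E m} (hx : ‖x‖ < 1) :
    weight α P x = cliffordSeries P (onePlusSqPowCoeff α) x := by
  have norm_sq_lt : |-‖x‖ ^ 2| < 1 := by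
    rw [abs_neg, abs_of_nonneg (sq_nonneg _)]
    exact (sq_lt_one_iff₀ (norm_nonneg x)).2 hx
  have even_part : HasSum (fun n => onePlusSqPowCoeff α (2 * n) • (vec x ^ (2 * n) * P x))
      (weight α P x) := by
    have even_term (n : ℕ) : onePlusSqPowCoeff α (2 * n) • (vec x ^ (2 * n) * P x) =
        (Ring.choose α n * (-‖x‖ ^ 2) ^ n) • P x := by
      rw [onePlusSqPowCoeff_two_mul, vec_pow_two_mul, ← Algebra.smul_def, smul_smul]
    simp_rw [even_term, weight, sub_eq_add_neg]
    exact (hasSum_ringChoose_mul_pow α norm_sq_lt).smul_const (P x)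
  have odd_part :
      HasSum (fun n => onePlusSqPowCoeff α (2 * n + 1) • (vec x ^ (2 * n + 1) * P x)) 0 := by
    simp_rw [onePlusSqPowCoeff_two_mul_add_one, zero_smul]
    exact hasSum_zero
  have all_terms :=
    HasSum.even_add_odd (f := fun l => onePlusSqPowCoeff α l • (vec x ^ l * P x)) even_part odd_part
  rw [cliffordSeries, all_terms.tsum_eq, add_zero]

theorem summable_ckTerm_weight (hP : IsHomogeneousMonogenic k P) (α : ℝ) {X : E (m + 1)}
    (hX : |X 0| + ‖vpart X‖ < 1) : Summable (ckTerm (weight α P) X) := by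
  have hx : ‖vpart X‖ < 1 := by linarith [abs_nonneg (X 0)]
  have weight_eq : weight α P =ᶠ[𝓝 (vpart X)] cliffordSeries P (onePlusSqPowCoeff α) := by
    filter_upwards [continuous_norm.continuousAt.eventually_lt_const hx] with y hy
    exact weight_eq_cliffordSeries α P hy
  refine (summable_ckTerm_cliffordSeries hP (summableOnDisk_onePlusSqPowCoeff α) hX).congr
    fun n => ?_
  rw [ckTerm, ckTerm, (iterate_dirac_eventuallyEq weight_eq n).eq_of_nhds]

end Weight

theorem natCast_add_half_sub_one (hm : Odd m) (k : ℕ) :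
    ((k + (m - 1) / 2 : ℕ) : ℝ) = k + ((m : ℝ) - 1) / 2 := by
  obtain ⟨p, rfl⟩ := hm
  rw [Nat.add_sub_cancel, Nat.mul_div_cancel_left p two_pos]
  push_cast
  ring

theorem analyticOnNhd_Ft_onePlusSqPow (k : ℕ) (β : ℝ) (hP : IsHomogeneousPolynomial k P) :
    AnalyticOnNhd ℝ (Ft k (onePlusSqPow β) P) {X | ‖vpart X‖ < 1} :=
  axialDomain_unitStrip m ▸ analyticOnNhd_Ft k isOpen_unitStrip (analyticOnNhd_onePlusSqPow β)
    (fun x _ => onePlusSqPow_ofReal_im β x) fun x _ => hP.analyticAt x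

theorem monogenicOn_Ft_onePlusSqPow (hm : Odd m) (β : ℝ) (hP : IsHomogeneousMonogenic k P) :
    MonogenicOn (Ft k (onePlusSqPow β) P) {X | ‖vpart X‖ < 1} :=
  axialDomain_unitStrip m ▸ monogenicOn_Ft hm isOpen_unitStrip (analyticOnNhd_onePlusSqPow β)
    (fun x _ => onePlusSqPow_ofReal_im β x) hP

theorem Ft_onePlusSqPow_eq_smul_CK (hm : Odd m) (α : ℝ) (hP : IsHomogeneousMonogenic k P)
    {X : E (m + 1)} (hX : |X 0| + ‖vpart X‖ < 1) :
    Ft k (onePlusSqPow (α + (k + (m - 1) / 2 : ℕ))) P X =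
      fueterConst m k α • CK (weight α P) X := by
  have isOpen_cylinder : IsOpen {X : E (m + 1) | ‖vpart X‖ < 1} :=
    axialDomain_unitStrip m ▸ isOpen_axialDomain isOpen_unitStrip
  have hx : ‖vpart X‖ < 1 := by linarith [abs_nonneg (X 0)]
  have restriction : (fun y => Ft k (onePlusSqPow (α + (k + (m - 1) / 2 : ℕ))) P (join 0 y))
      =ᶠ[𝓝 (vpart X)] fun y => fueterConst m k α • weight α P y := by
    filter_upwards [continuous_norm.continuousAt.eventually_lt_const hx] with y hy
    exact Ft_onePlusSqPow_join_zero hm α hP hy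
  have summable_of_mem (t : ℝ) (ht : t ∈ Metric.ball 0 (1 - ‖vpart X‖)) :
      Summable (ckTerm (fun y => fueterConst m k α • weight α P y) (join t (vpart X))) := by
    refine ((summable_ckTerm_weight hP α ?_).const_smul (fueterConst m k α)).congr fun n =>
      (ckTerm_const_smul _ _ _ n).symm
    rw [join_apply_zero, vpart_join]
    exact lt_sub_iff_add_lt.1 (mem_ball_zero_iff.1 ht)
  rw [← CK_const_smul, ← join_vpart X]
  exact eq_CK_of_cauchyRiemann_eq_zero isOpen_cylinder (analyticOnNhd_Ft_onePlusSqPow k _ hP.1)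
    (monogenicOn_Ft_onePlusSqPow hm _ hP).2 restriction
    (fun t _ => by simpa only [Set.mem_ofPred_eq, vpart_join] using hx) summable_of_mem
    (mem_ball_zero_iff.2 (lt_sub_iff_add_lt.2 hX))

end CliffordFueter

end

theorem mainTheorem2 (m : ℕ) (hm : Odd m) (k : ℕ) (α : ℝ)
    (P : CliffordFueter.E m → CliffordFueter.Cl m)
    (hP : CliffordFueter.IsHomogeneousMonogenic k P) :
    (∀ X : CliffordFueter.E (m + 1), |X 0| + ‖CliffordFueter.vpart X‖ < 1 →
      Summable (CliffordFueter.ckTerm (CliffordFueter.weight α P) X) ∧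
      CliffordFueter.Ft k
          (CliffordFueter.onePlusSqPow (α + (k : ℝ) + ((m : ℝ) - 1) / 2)) P X =
        CliffordFueter.fueterConst m k α •
          CliffordFueter.CK (CliffordFueter.weight α P) X) ∧
    CliffordFueter.IsMonogenicExtension
      (fun x => CliffordFueter.fueterConst m k α • CliffordFueter.weight α P x)
      (Metric.ball 0 1)
      (CliffordFueter.Ft k
        (CliffordFueter.onePlusSqPow (α + (k : ℝ) + ((m : ℝ) - 1) / 2)) P)
      {X : CliffordFueter.E (m + 1) | ‖CliffordFueter.vpart X‖ < 1} := by
  rw [add_assoc α, ← CliffordFueter.natCast_add_half_sub_one hm k]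
  refine ⟨fun X hX => ⟨CliffordFueter.summable_ckTerm_weight hP α hX,
    CliffordFueter.Ft_onePlusSqPow_eq_smul_CK hm α hP hX⟩,
    CliffordFueter.monogenicOn_Ft_onePlusSqPow hm _ hP, fun X hX₀ hX => ?_⟩
  have norm_lt : ‖CliffordFueter.vpart X‖ < 1 := mem_ball_zero_iff.1 hX
  refine ⟨norm_lt, ?_⟩
  beta_reduce
  rw [← CliffordFueter.Ft_onePlusSqPow_join_zero hm α hP norm_lt, ← hX₀,
    CliffordFueter.join_vpart]
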